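/- Fix a number $m\ge 1$ of candidates $c_1,\dots,c_m$. An instance of the protection problem consists of a scoring rule, i.e. numbers $\alpha_1\ge\alpha_2\ge\dots\ge\alpha_m$ in $\mathbb{N}=\{0,1,2,\dots\}$; finitely many voters $v_1,\dots,v_n$, where $v_j$ has a preference list $\tau_j$ (a permutation of the candidates), a weight $w_j\in\mathbb{Z}_{>0}$, an awarding price $p^a_j\in\mathbb{Z}_{>0}$ and a bribing price $p^b_j\in\mathbb{Z}_{>0}$; a defense budget $F\in\mathbb{Z}_{\ge 0}$ and an attack budget $B\in\mathbb{Z}_{\ge 0}$. A voter $v_j$ who reports a list with candidate $c$ at position $i$ contributes $w_j\alpha_i$ to the total score of $c$. The defender awards a set $\mathcal{V}_F$ of voters with $\sum_{v_j\in\mathcal{V}_F}p^a_j\le F$; then the attacker bribes a set $\mathcal{V}_B$ of non-awarded voters with $\sum_{v_j\in\mathcal{V}_B}p^b_j\le B$ and replaces their lists by arbitrary ones, while all other voters report their own lists. The constructive attacker succeeds if $c_m$ then has a strictly higher score than every other candidate; the destructive attacker succeeds if some other candidate then has a strictly higher score than $c_m$. The constructive (destructive) protection problem asks whether there is a set $\mathcal{V}_F$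 within the defense budget such that the constructive (destructive) attacker cannot succeed, whatever $\mathcal{V}_B$ and new lists are chosen. The symmetric \$-protection problem is the special case where $w_j=1$ and $p^a_j=p^b_j$ for every $j$. Theorem. For every constant number $m$ of candidates and any scoring rule (which is a part of the input), both the constructive and the destructive symmetric \$-protection problems are in $\mathrm{P}$: they are decided by Turing machines in time polynomial in the length of the input, where all numbers (scores, weights, prices, budgets) are written in binary. -/

import Mathlib

/-- A scoring rule for `m + 1` candidates: `score i` is the number of points that a voter gives to
the candidate at position `i` of the preference list, and these numbers do not increase. -/
structure ScoringRule (m : ℕ) where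
  score : Fin (m + 1) → ℕ
  antitone : Antitone score

/-- A voter in an election with candidates `Fin (m + 1)`.  `pref i` is the candidate at position `i`
of the preference list (position `0` is the top). -/
structure Voter (m : ℕ) where
  pref : Equiv.Perm (Fin (m + 1))
  weight : ℕ
  awardPrice : ℕ
  bribePrice : ℕ
  weight_pos : 0 < weight
  awardPrice_pos : 0 < awardPrice
  bribePrice_pos : 0 < bribePrice

/-- An input of the (weighted, priced) protection problem with `m + 1` candidates.  The last
candidate `Fin.last m` is the one that the attacker wants to win (constructive problem) or to lose
(destructive problem). -/
structure ProtectionInstance (m : ℕ) where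
  rule : ScoringRule m
  defenseBudget : ℕ
  attackBudget : ℕ
  voters : List (Voter m)

namespace ProtectionInstance

variable {m : ℕ} (I : ProtectionInstance m)

/-- The `j`-th voter. -/
def voter (j : Fin I.voters.length) : Voter m := I.voters.get j

/-- Total (weighted) score of candidate `c` when voter `j` reports the preference list `π j`. -/
def totalScore (π : Fin I.voters.length → Equiv.Perm (Fin (m + 1))) (c : Fin (m + 1)) : ℕ :=
  ∑ j, (I.voter j).weight * I.rule.score ((π j).symm c)

/-- The defender can afford to award the voters in `VF`. -/
def Affordable (VF : Finset (Fin I.voters.length)) : Prop :=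
  ∑ j ∈ VF, (I.voter j).awardPrice ≤ I.defenseBudget

/-- `π` is a profile of reported preference lists that the attacker can bring about when the voters
in `VF` are awarded: the attacker bribes a set `VB` of voters that are not awarded, within the
budget; bribed voters report arbitrary lists, all others report their own lists. -/
def Reachable (VF : Finset (Fin I.voters.length))
    (π : Fin I.voters.length → Equiv.Perm (Fin (m + 1))) : Prop :=
  ∃ VB : Finset (Fin I.voters.length), Disjoint VB VF ∧
    ∑ j ∈ VB, (I.voter j).bribePrice ≤ I.attackBudget ∧
    ∀ j, j ∉ VB → π j = (I.voter j).pref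

/-- The last candidate is the only candidate with the highest score. -/
def DesignatedWins (π : Fin I.voters.length → Equiv.Perm (Fin (m + 1))) : Prop :=
  ∀ c, c ≠ Fin.last m → I.totalScore π c < I.totalScore π (Fin.last m)

/-- Some other candidate gets a strictly higher score than the last candidate. -/
def DesignatedLoses (π : Fin I.voters.length → Equiv.Perm (Fin (m + 1))) : Prop :=
  ∃ c, c ≠ Fin.last m ∧ I.totalScore π (Fin.last m) < I.totalScore π c

/-- The answer to the constructive protection problem is "yes". -/
def ConstructiveYes : Prop :=
  ∃ VF, I.Affordable VF ∧ ∀ π, I.Reachable VF π → ¬ I.DesignatedWins π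

/-- The answer to the destructive protection problem is "yes". -/
def DestructiveYes : Prop :=
  ∃ VF, I.Affordable VF ∧ ∀ π, I.Reachable VF π → ¬ I.DesignatedLoses π

/-- All voters have weight one (the "dollar" problem). -/
def UnitWeights : Prop := ∀ v ∈ I.voters, v.weight = 1

/-- Awarding price and bribing price of each voter coincide. -/
def Symmetric : Prop := ∀ v ∈ I.voters, v.awardPrice = v.bribePrice

end ProtectionInstance

/-- The input alphabet for `m + 1` candidates, a finite set: the two bits, an end mark for numbers,
and one letter for each preference list. -/
inductive InputSymbol (m : ℕ) : Type
  | bit (b : Bool)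
  | endNum
  | pref (τ : Equiv.Perm (Fin (m + 1)))

/-- A number in binary (least significant bit first, `0` has no bits), followed by an end mark. -/
def encodeNumber {m : ℕ} (k : ℕ) : List (InputSymbol m) :=
  k.bits.map InputSymbol.bit ++ [InputSymbol.endNum]

/-- A voter: preference list, weight, awarding price, bribing price. -/
def Voter.encode {m : ℕ} (v : Voter m) : List (InputSymbol m) :=
  InputSymbol.pref v.pref ::
    (encodeNumber v.weight ++ encodeNumber v.awardPrice ++ encodeNumber v.bribePrice)

/-- An instance as a word: scores of the rule, the two budgets, the voters. -/
def ProtectionInstance.encode {m : ℕ} (I : ProtectionInstance m) : List (InputSymbol m) :=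
  (List.ofFn I.rule.score).flatMap encodeNumber ++ encodeNumber I.defenseBudget ++
    encodeNumber I.attackBudget ++ I.voters.flatMap Voter.encode

/-- The constructive symmetric dollar-protection problem with `m + 1` candidates, as a language. -/
def constructiveSymmetricDollarProtection (m : ℕ) : Language (InputSymbol m) :=
  {w | ∃ I : ProtectionInstance m,
    I.encode = w ∧ I.UnitWeights ∧ I.Symmetric ∧ I.ConstructiveYes}

/-- The destructive symmetric dollar-protection problem with `m + 1` candidates, as a language. -/
def destructiveSymmetricDollarProtection (m : ℕ) : Language (InputSymbol m) :=
  {w | ∃ I : ProtectionInstance m,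
    I.encode = w ∧ I.UnitWeights ∧ I.Symmetric ∧ I.DestructiveYes}

open Classical in
/-- The class P: a Turing machine decides membership in `L` for every word over the alphabet, in a
number of steps that is bounded by a polynomial in the length of the word. -/
def InP {Γ : Type} (L : Language Γ) : Prop :=
  Nonempty (Turing.TM2ComputableInPolyTime (id : List Γ → List Γ) Computability.encodeBool
    (fun w => decide (w ∈ L)))

/-!
The voters of one preference list are interchangeable except for their prices, and in the symmetric
problem one price governs both awarding and bribing. This gives an exchange argument
(`exists_protection_iff`). Replacing an awarded voter by a cheaper one with the same list costs the
defender less, and it makes the attacker pay more for the same effect; dually, the attacker may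
bribe the cheapest voters that are left. Hence both players may be restricted to *lower sets*: sets
that contain, with a voter, all cheaper voters with the same list, ties being broken in a fixed way.
The defender awards a lower set `L`, and the attacker bribes `L' \ L` for a lower set `L'`. A lower
set is determined by the most expensive voter of each type in it
(`IsLowerSetOf.exists_generators`), so for a fixed number `m + 1` of candidates there are only
polynomially many of them. What the bribed voters report matters only up to the order, that is, it
matters how often each of the `(m + 1)!` lists is reported, and again there are polynomially many
possibilities (`exists_mem_blockLists_perm`). The procedure `isProtectable` searches through all of
this; it is correct by `isProtectable_iff`.

To place the procedure in the class P, structured programs on finitely many stacks are compiled to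
Mathlib's `TM2` machines with an exact step count (`StackCmd.Exec.iterate_step`). Data are binary
trees that are stored on a stack in prefix code, and `PolyTime f` says that a program replaces the
code of `a` by the code of `f a` in time polynomial in the size of `a`. These functions are closed
under composition, pairing, case distinction, and folds whose state grows by a bounded amount in
each step (`PolyTime.foldl_of_measure`), which suffices for binary arithmetic and for the
enumerations above. Finally, `PolyTime.inP` turns a `PolyTime` predicate on words into membership
in P, and `parse` reads an instance from a word.
-/

/-! ### Structured stack programs -/

open Turing

/-- Structured programs that act on a finite family of stacks and on a register of type `σ`.
They are compiled to the statements of Mathlib's `Turing.TM2` machines.  The tests of `branch` and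
`repeatWhile` see only the register, so a stack has to be popped before it can be inspected. -/
inductive StackCmd {K : Type} (Γ : K → Type) (σ : Type) : Type
  | push (k : K) (f : σ → Γ k) : StackCmd Γ σ
  | pop (k : K) (f : σ → Option (Γ k) → σ) : StackCmd Γ σ
  | load (f : σ → σ) : StackCmd Γ σ
  | seq (c₁ c₂ : StackCmd Γ σ) : StackCmd Γ σ
  | branch (f : σ → StackCmd Γ σ) : StackCmd Γ σ
  | repeatWhile (p : σ → Bool) (c : StackCmd Γ σ) : StackCmd Γ σ

namespace StackCmd

variable {K : Type} {Γ : K → Type} {σ : Type}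

/-- Big-step semantics: `Exec c v S v' S' n` says that `c`, started with register `v` and stacks
`S`, stops with register `v'` and stacks `S'` after exactly `n` machine steps. -/
inductive Exec [DecidableEq K] : StackCmd Γ σ → σ → (∀ k, List (Γ k)) → σ →
    (∀ k, List (Γ k)) → ℕ → Prop
  | push (k f v S) : Exec (push k f) v S v (Function.update S k (f v :: S k)) 1
  | pop (k f v S) : Exec (pop k f) v S (f v (S k).head?) (Function.update S k (S k).tail) 1
  | load (f v S) : Exec (load f) v S (f v) S 1
  | seq {c₁ c₂ v S v₁ S₁ v₂ S₂ n₁ n₂} : Exec c₁ v S v₁ S₁ n₁ → Exec c₂ v₁ S₁ v₂ S₂ n₂ →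
      Exec (seq c₁ c₂) v S v₂ S₂ (n₁ + n₂)
  | branch {f v S v' S' n} : Exec (f v) v S v' S' n → Exec (branch f) v S v' S' (n + 1)
  | repeatWhile_done {p c v S} : p v = false → Exec (.repeatWhile p c) v S v S 1
  | repeatWhile_step {p c v S v₁ S₁ v₂ S₂ n₁ n₂} : p v = true → Exec c v S v₁ S₁ n₁ →
      Exec (.repeatWhile p c) v₁ S₁ v₂ S₂ n₂ → Exec (.repeatWhile p c) v S v₂ S₂ (n₁ + n₂ + 1)

/-- The control points of a program, used as labels of the compiled machine. -/
def Label : StackCmd Γ σ → Type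
  | push _ _ => Unit
  | pop _ _ => Unit
  | load _ => Unit
  | seq c₁ c₂ => c₁.Label ⊕ c₂.Label
  | branch f => Option (Σ v, (f v).Label)
  | .repeatWhile _ c => Option c.Label

/-- Finiteness of the register type is essential: `branch` has one sub-program for each value. -/
theorem finite_label [Finite σ] : ∀ c : StackCmd Γ σ, Finite c.Label
  | push _ _ => inferInstanceAs (Finite Unit)
  | pop _ _ => inferInstanceAs (Finite Unit)
  | load _ => inferInstanceAs (Finite Unit)
  | seq c₁ c₂ => by
      have := finite_label c₁
      have := finite_label c₂
      exact inferInstanceAs (Finite (c₁.Label ⊕ c₂.Label))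
  | branch f => by
      have := fun v => finite_label (f v)
      exact inferInstanceAs (Finite (Option (Σ v, (f v).Label)))
  | .repeatWhile _ c => by
      have := finite_label c
      exact inferInstanceAs (Finite (Option c.Label))

/-- The control point where a program starts. -/
def entry : (c : StackCmd Γ σ) → c.Label
  | push _ _ => ()
  | pop _ _ => ()
  | load _ => ()
  | seq c₁ _ => Sum.inl c₁.entry
  | branch _ => (none : Option _)
  | .repeatWhile _ _ => (none : Option _)

/-- The machine code at a control point of a program whose control points are embedded by `emb`
into the labels of a machine, and which jumps to `next` when it is done. -/
def code {Λ : Type} : (c : StackCmd Γ σ) → (emb : c.Label → Λ) → (next : Λ) → c.Label →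
    TM2.Stmt Γ Λ σ
  | push k f, _, next, _ => .push k f (.goto fun _ => next)
  | pop k f, _, next, _ => .pop k f (.goto fun _ => next)
  | load f, _, next, _ => .load f (.goto fun _ => next)
  | seq c₁ c₂, emb, _, Sum.inl l => c₁.code (fun l => emb (Sum.inl l)) (emb (Sum.inr c₂.entry)) l
  | seq _ c₂, emb, next, Sum.inr l => c₂.code (fun l => emb (Sum.inr l)) next l
  | branch f, emb, _, none => .goto fun v => emb (some ⟨v, (f v).entry⟩ : Option (Σ v, (f v).Label))
  | branch f, emb, next, some ⟨v, l⟩ =>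
      (f v).code (fun l => emb (some ⟨v, l⟩ : Option (Σ v, (f v).Label))) next l
  | .repeatWhile p c, emb, next, none =>
      .branch p (.goto fun _ => emb (some c.entry : Option c.Label)) (.goto fun _ => next)
  | .repeatWhile _ c, emb, _, some l =>
      c.code (fun l => emb (some l : Option c.Label)) (emb (none : Option c.Label)) l

/-- The compiled machine simulates the big-step semantics step by step. -/
theorem Exec.iterate_step [DecidableEq K] {c : StackCmd Γ σ} {v S v' S' n}
    (h : Exec c v S v' S' n) {Λ : Type} (M : Λ → TM2.Stmt Γ Λ σ) (emb : c.Label → Λ) (next : Λ)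
    (hM : ∀ l, M (emb l) = c.code emb next l) :
    (flip bind (TM2.step M))^[n] (some ⟨some (emb c.entry), v, S⟩) = some ⟨some next, v', S'⟩ := by
  induction h generalizing next with
  | push k f v S => simp [flip, hM, code]
  | pop k f v S => simp [flip, hM, code]
  | load f v S => simp [flip, hM, code]
  | @seq c₁ c₂ _ _ _ _ _ _ n₁ n₂ _ _ ih₁ ih₂ =>
      have h₁ := ih₁ (fun l => emb (Sum.inl l)) (emb (Sum.inr c₂.entry))
        (fun l => hM (Sum.inl l))
      have h₂ := ih₂ (fun l => emb (Sum.inr l)) next (fun l => hM (Sum.inr l))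
      rw [Nat.add_comm, Function.iterate_add_apply, ← h₂]
      exact congrArg _ h₁
  | @branch f v S _ _ n _ ih =>
      rw [Function.iterate_succ_apply,
        ← ih (fun l => emb (some ⟨v, l⟩ : Option (Σ v, (f v).Label))) next
          (fun l => hM (some ⟨v, l⟩ : Option (Σ v, (f v).Label)))]
      congr 1
      have h₀ := hM (none : Option (Σ v, (f v).Label))
      simp only [flip, entry, Option.bind_eq_bind, Option.bind_some, TM2.step, code] at h₀ ⊢
      rw [h₀]
      simp
  | @repeatWhile_done p c v S hp =>
      have h₀ := hM (none : Option c.Label)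
      simp only [flip, entry, Option.bind_eq_bind, Option.bind_some, TM2.step, code,
        Function.iterate_one] at h₀ ⊢
      rw [h₀]
      simp [hp]
  | @repeatWhile_step p c v S v₁ _ _ _ n₁ n₂ hp _ _ ih₁ ih₂ =>
      have h₁ := ih₁ (fun l => emb (some l : Option c.Label)) (emb (none : Option c.Label))
        (fun l => hM (some l : Option c.Label))
      rw [Function.iterate_succ_apply, Nat.add_comm n₁, Function.iterate_add_apply,
        ← ih₂ emb next hM]
      congr 1
      refine Eq.trans ?_ h₁
      congr 1
      have h₀ := hM (none : Option c.Label)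
      simp only [flip, entry, Option.bind_eq_bind, Option.bind_some, TM2.step, code] at h₀ ⊢
      rw [h₀]
      simp [hp]

end StackCmd

/-! ### Trees on stacks -/

/-- Binary trees, the universal data type of the stack programs. -/
inductive BinTree : Type
  | nil
  | cons (a b : BinTree)

namespace BinTree

/-- Prefix code of a tree; no proper prefix of a code is a code. -/
def code : BinTree → List Bool
  | nil => [false]
  | cons a b => true :: (a.code ++ b.code)

/-- Number of symbols in the prefix code. -/
def size (t : BinTree) : ℕ := t.code.length

@[simp] theorem size_nil : size nil = 1 := rfl

@[simp] theorem size_cons (a b : BinTree) : size (cons a b) = size a + size b + 1 := by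
  simp [size, code]

theorem size_pos (t : BinTree) : 0 < t.size := by cases t <;> simp

/-- The prefix code as a word over the alphabet of the work stacks. -/
def word (t : BinTree) : List (Option Bool) := t.code.map some

@[simp] theorem word_nil : word nil = [some false] := rfl

@[simp] theorem word_cons (a b : BinTree) :
    word (cons a b) = some true :: (a.word ++ b.word) := by
  simp [word, code]

end BinTree

/-- The stacks of the machines: input, output, and four work stacks.  Data live on `main` as prefix
codes of trees, `aux` keeps saved trees, `copy` and `count` are empty between operations. -/
inductive StackName : Type
  | input | output | main | aux | copy | count
  deriving DecidableEq

instance : Fintype StackName :=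
  ⟨{.input, .output, .main, .aux, .copy, .count}, fun k => by cases k <;> decide⟩

/-- Stack alphabets.  On the work stacks `none` is a separator. -/
abbrev StackAlphabet (I : Type) : StackName → Type
  | .input => I
  | .output => Bool
  | .main => Option Bool
  | .aux => Option Bool
  | .copy => Option Bool
  | .count => Option Bool

/-- The register holds the symbol popped last; `none` means that the stack was empty. -/
abbrev StackRegister (I : Type) : Type := Option (I ⊕ Option Bool)

/-- The family of stacks with given contents. -/
def stk {I : Type} (inp : List I) (out : List Bool) (M A B C : List (Option Bool)) :
    ∀ k, List (StackAlphabet I k)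
  | .input => inp
  | .output => out
  | .main => M
  | .aux => A
  | .copy => B
  | .count => C

namespace StackCmd

variable {I : Type} {inp : List I} {out : List Bool} {M A B C : List (Option Bool)}

/-- Programs over the concrete stacks with input alphabet `I`. -/
abbrev Program (I : Type) : Type := StackCmd (StackAlphabet I) (StackRegister I)

/-- `c` takes the stacks `S` to `S'` in at most `b` steps, whatever the register holds. -/
def Does (c : Program I) (S S' : ∀ k, List (StackAlphabet I k)) (b : ℕ) : Prop :=
  ∀ v, ∃ v' n, n ≤ b ∧ Exec c v S v' S' n

variable {c c₁ c₂ : Program I} {S S₁ S₂ : ∀ k, List (StackAlphabet I k)} {b b₁ b₂ : ℕ}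

theorem Does.mono (h : Does c S S₁ b₁) (hb : b₁ ≤ b₂) : Does c S S₁ b₂ := fun v =>
  let ⟨v', n, hn, e⟩ := h v
  ⟨v', n, hn.trans hb, e⟩

theorem Does.seq (h₁ : Does c₁ S S₁ b₁) (h₂ : Does c₂ S₁ S₂ b₂) :
    Does (seq c₁ c₂) S S₂ (b₁ + b₂) := fun v =>
  let ⟨v₁, _, hn₁, e₁⟩ := h₁ v
  let ⟨v₂, _, hn₂, e₂⟩ := h₂ v₁
  ⟨v₂, _, Nat.add_le_add hn₁ hn₂, e₁.seq e₂⟩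

/-- Push a fixed symbol. -/
def put (k : StackName) (x : StackAlphabet I k) : Program I := push k fun _ => x

theorem does_put (k : StackName) (x : StackAlphabet I k) :
    Does (put k x) S (Function.update S k (x :: S k)) 1 :=
  fun v => ⟨v, 1, le_rfl, Exec.push k _ v S⟩

theorem does_put_main (x : Option Bool) : Does (put .main x) (stk inp out M A B C)
    (stk inp out (x :: M) A B C) 1 := by
  convert does_put (I := I) .main x using 1
  funext k; cases k <;> rfl

theorem does_put_aux (x : Option Bool) : Does (put .aux x) (stk inp out M A B C)
    (stk inp out M (x :: A) B C) 1 := by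
  convert does_put (I := I) .aux x using 1
  funext k; cases k <;> rfl

theorem does_put_copy (x : Option Bool) : Does (put .copy x) (stk inp out M A B C)
    (stk inp out M A (x :: B) C) 1 := by
  convert does_put (I := I) .copy x using 1
  funext k; cases k <;> rfl

theorem does_put_count (x : Option Bool) : Does (put .count x) (stk inp out M A B C)
    (stk inp out M A B (x :: C)) 1 := by
  convert does_put (I := I) .count x using 1
  funext k; cases k <;> rfl

theorem does_put_output (x : Bool) : Does (put .output x) (stk inp out M A B C)
    (stk inp (x :: out) M A B C) 1 := by
  convert does_put (I := I) .output x using 1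
  funext k; cases k <;> rfl

/-- Register content for a symbol of stack `k`. -/
def toRegister : (k : StackName) → StackAlphabet I k → I ⊕ Option Bool
  | .input => fun x => Sum.inl x
  | .output => fun x => Sum.inr (some x)
  | .main => fun x => Sum.inr x
  | .aux => fun x => Sum.inr x
  | .copy => fun x => Sum.inr x
  | .count => fun x => Sum.inr x

/-- Pop stack `k` into the register. -/
def fetch (k : StackName) : Program I := pop k fun _ o => o.map (toRegister k)

/-- Pop stack `k` and continue depending on the symbol. -/
def fetchCase (k : StackName) (f : StackRegister I → Program I) : Program I :=
  seq (fetch k) (branch f)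

theorem does_fetchCase {k : StackName} {f : StackRegister I → Program I}
    (h : Does (f ((S k).head?.map (toRegister k))) (Function.update S k (S k).tail) S₁ b) :
    Does (fetchCase k f) S S₁ (b + 2) := fun v =>
  let ⟨v₁, n, hn, e⟩ := h ((S k).head?.map (toRegister k))
  ⟨v₁, 1 + (n + 1), by omega, (Exec.pop k _ v S).seq e.branch⟩

/-- Pop stack `k`; as long as the popped symbol satisfies `p`, run the body for it and pop again. -/
def fetchLoop (k : StackName) (p : StackRegister I → Bool) (f : StackRegister I → Program I) :
    Program I :=
  seq (fetch k) (repeatWhile p (seq (branch f) (fetch k)))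

/-- `does_fetchLoop_done` and `does_fetchLoop_step` describe `fetchLoop` by recursion on the number
of passes; each pass ends where the loop would start afresh. -/
theorem does_fetchLoop_done {k : StackName} {p : StackRegister I → Bool}
    {f : StackRegister I → Program I} (hp : p ((S k).head?.map (toRegister k)) = false)
    (hS : Function.update S k (S k).tail = S₁) : Does (fetchLoop k p f) S S₁ 2 := fun v =>
  ⟨_, 1 + 1, le_rfl, hS ▸ (Exec.pop k _ v S).seq (Exec.repeatWhile_done hp)⟩

theorem does_fetchLoop_step {k : StackName} {p : StackRegister I → Bool}
    {f : StackRegister I → Program I} (hp : p ((S k).head?.map (toRegister k)) = true)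
    (h₁ : Does (f ((S k).head?.map (toRegister k))) (Function.update S k (S k).tail) S₁ b₁)
    (h₂ : Does (fetchLoop k p f) S₁ S₂ b₂) : Does (fetchLoop k p f) S S₂ (b₁ + b₂ + 3) := by
  intro v
  obtain ⟨v₁, n₁, hn₁, e₁⟩ := h₁ ((S k).head?.map (toRegister k))
  obtain ⟨v₂, n₂, hn₂, e₂⟩ := h₂ v₁
  cases e₂ with
  | @seq _ _ _ _ _ _ _ _ m₁ m₂ e₃ e₄ =>
    exact ⟨v₂, _, by omega,
      (Exec.pop k _ v S).seq (Exec.repeatWhile_step hp (e₁.branch.seq e₃) e₄)⟩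

theorem update_stk_input (l : List I) : Function.update (stk inp out M A B C) .input l =
    stk l out M A B C := by
  funext k; cases k <;> rfl

theorem update_stk_main (l : List (Option Bool)) :
    Function.update (stk inp out M A B C) .main l = stk inp out l A B C := by
  funext k; cases k <;> rfl

theorem update_stk_aux (l : List (Option Bool)) :
    Function.update (stk inp out M A B C) .aux l = stk inp out M l B C := by
  funext k; cases k <;> rfl

theorem update_stk_copy (l : List (Option Bool)) :
    Function.update (stk inp out M A B C) .copy l = stk inp out M A l C := by
  funext k; cases k <;> rfl

theorem update_stk_count (l : List (Option Bool)) :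
    Function.update (stk inp out M A B C) .count l = stk inp out M A B l := by
  funext k; cases k <;> rfl

theorem does_fetchCase_main {x : Option Bool} {f : StackRegister I → Program I}
    (h : Does (f (some (.inr x))) (stk inp out M A B C) S₁ b) :
    Does (fetchCase .main f) (stk inp out (x :: M) A B C) S₁ (b + 2) := by
  apply does_fetchCase
  rw [update_stk_main]
  exact h

theorem does_fetch_main {x : Option Bool} :
    Does (fetch .main) (stk inp out (x :: M) A B C) (stk inp out M A B C) 1 := fun v =>
  ⟨_, 1, le_rfl, by
    have := Exec.pop (StackName.main) (fun _ o => o.map (toRegister _)) v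
      (stk inp out (x :: M) A B C)
    rw [update_stk_main] at this
    exact this⟩

/-- Whether the register holds a bit (and neither a separator nor the end of a stack). -/
def isBit : StackRegister I → Bool
  | some (.inr (some _)) => true
  | _ => false

/-- The symbol of the work stacks in the register. -/
def regSymbol : StackRegister I → Option Bool
  | some (.inr x) => x
  | _ => none

/-- Whether the register holds the symbol that starts the code of a compound tree. -/
def isCons : StackRegister I → Bool
  | some (.inr (some b)) => b
  | _ => false

/-- Move the tree on top of `main` to `aux`, in reverse and on top of a separator.  The stack
`count` holds one symbol for each tree that has to be read to complete the current one. -/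
def save : Program I :=
  seq (put .aux none) <| seq (put .count none) <|
    fetchLoop .count Option.isSome fun _ => fetchCase .main fun v =>
      seq (put .aux (regSymbol v)) <|
        if isCons v then seq (put .count none) (put .count none) else load id

/-- The loop of `save` moves one tree and then does whatever it does on the remaining stacks.  In
this form the claim can be applied to the two subtrees in succession. -/
theorem does_saveLoop (t : BinTree) {M A B C : List (Option Bool)}
    (h : Does (fetchLoop .count Option.isSome fun _ => fetchCase .main fun v =>
        seq (put .aux (regSymbol v)) <|
          if isCons v then seq (put .count none) (put .count none) else load id)
      (stk inp out M (t.word.reverse ++ A) B C) S b) :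
    Does (fetchLoop .count Option.isSome fun _ => fetchCase .main fun v =>
        seq (put .aux (regSymbol v)) <|
          if isCons v then seq (put .count none) (put .count none) else load id)
      (stk inp out (t.word ++ M) A B (none :: C)) S (b + 8 * t.size) := by
  induction t generalizing M A C b with
  | nil =>
    refine (does_fetchLoop_step (b₁ := 4) (S₁ := stk inp out M (some false :: A) B C) (by rfl) ?_
      h).mono (by simp; omega)
    rw [update_stk_count]
    apply does_fetchCase_main (b := 2)
    refine (does_put_aux _).seq (b₂ := 1) ?_
    exact fun v => ⟨v, 1, le_rfl, Exec.load _ _ _⟩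
  | cons s t ihs iht =>
    simp only [BinTree.word_cons, List.reverse_cons, List.reverse_append, List.append_assoc,
      List.cons_append] at h ⊢
    have h' := ihs (iht h)
    refine (does_fetchLoop_step (b₁ := 5) (by rfl) ?_ h').mono (by simp; omega)
    rw [update_stk_count]
    apply does_fetchCase_main (b := 3)
    exact (does_put_aux _).seq (b₂ := 2) ((does_put_count _).seq (does_put_count _))

theorem does_save (t : BinTree) : Does save (stk inp out (t.word ++ M) A B [])
    (stk inp out M (t.word.reverse ++ none :: A) B []) (8 * t.size + 4) := by
  refine ((does_put_aux none).seq ((does_put_count none).seq (does_saveLoop t (b := 2) ?_))).mono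
    (by omega)
  exact does_fetchLoop_done (by rfl) (update_stk_count _)

/-- Move the bits on top of `aux`, down to a separator, to `main`. -/
def restore : Program I := fetchLoop .aux isBit fun v => put .main (regSymbol v)

theorem does_restore_bits (l : List Bool) :
    Does restore (stk inp out M (l.map some ++ none :: A) B C)
      (stk inp out (l.reverse.map some ++ M) A B C) (4 * l.length + 2) := by
  induction l generalizing M with
  | nil =>
    exact does_fetchLoop_done (by rfl) (update_stk_aux _)
  | cons x l ih =>
    refine (does_fetchLoop_step (b₁ := 1)
      (S₁ := stk inp out (some x :: M) (l.map some ++ none :: A) B C) (by rfl) ?_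
      (b₂ := 4 * l.length + 2) ?_).mono (by simp; omega)
    · rw [update_stk_aux]
      exact does_put_main _
    · simpa [restore] using ih (M := some x :: M)

theorem does_restore (t : BinTree) : Does restore (stk inp out M (t.word.reverse ++ none :: A) B C)
    (stk inp out (t.word ++ M) A B C) (4 * t.size + 2) := by
  have h := does_restore_bits (inp := inp) (out := out) (M := M) (A := A) (B := B) (C := C)
    t.code.reverse
  simpa [BinTree.word, BinTree.size] using h

/-- Delete the tree on top of `main`: save it, which finds its end, and discard the saved bits. -/
def drop : Program I := seq save (fetchLoop .aux isBit fun _ => load id)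

theorem does_discard_bits (l : List Bool) :
    Does (fetchLoop .aux isBit fun _ => load id) (stk inp out M (l.map some ++ none :: A) B C)
      (stk inp out M A B C) (4 * l.length + 2) := by
  induction l generalizing M with
  | nil =>
    exact does_fetchLoop_done (by rfl) (update_stk_aux _)
  | cons x l ih =>
    refine (does_fetchLoop_step (b₁ := 1) (by rfl) ?_ (b₂ := 4 * l.length + 2) ih).mono
      (by simp; omega)
    rw [update_stk_aux]
    exact fun v => ⟨v, 1, le_rfl, Exec.load _ _ _⟩

theorem does_drop (t : BinTree) : Does drop (stk inp out (t.word ++ M) A B [])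
    (stk inp out M A B []) (12 * t.size + 6) := by
  refine ((does_save t).seq (b₂ := 4 * t.size + 2) ?_).mono (by omega)
  have h := does_discard_bits (inp := inp) (out := out) (M := M) (A := A) (B := B) (C := [])
    t.code.reverse
  simpa [BinTree.word, BinTree.size] using h

/-- Duplicate the tree on top of `main`.  The saved tree is moved to `main` and `copy` at the same
time; the code on `copy` then takes the way over `aux`, which keeps its direction. -/
def dup : Program I :=
  seq save <|
    seq (fetchLoop .aux isBit fun v => seq (put .main (regSymbol v)) (put .copy (regSymbol v))) <|
      seq (put .aux none) <|
        seq (fetchLoop .copy isBit fun v => put .aux (regSymbol v)) restore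

theorem does_copyOut (l : List Bool) :
    Does (fetchLoop .aux isBit fun v => seq (put .main (regSymbol v)) (put .copy (regSymbol v)))
      (stk inp out M (l.map some ++ none :: A) B C)
      (stk inp out (l.reverse.map some ++ M) A (l.reverse.map some ++ B) C)
      (5 * l.length + 2) := by
  induction l generalizing M B with
  | nil =>
    exact does_fetchLoop_done (by rfl) (update_stk_aux _)
  | cons x l ih =>
    refine (does_fetchLoop_step (b₁ := 2)
      (S₁ := stk inp out (some x :: M) (l.map some ++ none :: A) (some x :: B) C)
      (by rfl) ?_ (b₂ := 5 * l.length + 2) ?_).mono (by simp; omega)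
    · rw [update_stk_aux]
      exact (does_put_main _).seq (does_put_copy _)
    · simpa using ih (M := some x :: M) (B := some x :: B)

theorem does_copyBack (l : List Bool) :
    Does (fetchLoop .copy isBit fun v => put .aux (regSymbol v))
      (stk inp out M A (l.map some) C)
      (stk inp out M (l.reverse.map some ++ A) [] C) (4 * l.length + 2) := by
  induction l generalizing A with
  | nil =>
    exact does_fetchLoop_done (by rfl) (update_stk_copy _)
  | cons x l ih =>
    refine (does_fetchLoop_step (b₁ := 1) (S₁ := stk inp out M (some x :: A) (l.map some) C)
      (by rfl) ?_ (b₂ := 4 * l.length + 2) ?_).mono (by simp; omega)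
    · rw [update_stk_copy]
      exact does_put_aux _
    · simpa using ih (A := some x :: A)

theorem does_dup (t : BinTree) : Does dup (stk inp out (t.word ++ M) A [] [])
    (stk inp out (t.word ++ (t.word ++ M)) A [] []) (21 * t.size + 11) := by
  have h₁ := does_copyOut (inp := inp) (out := out) (M := M) (A := A) (B := []) (C := [])
    t.code.reverse
  have h₂ := does_copyBack (inp := inp) (out := out) (M := t.word ++ M) (A := none :: A) (C := [])
    t.code
  simp only [List.reverse_reverse, List.map_reverse, List.length_reverse, List.append_nil] at h₁ h₂
  exact ((does_save t).seq (h₁.seq ((does_put_aux none).seq (h₂.seq (does_restore t))))).mono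
    (by simp only [BinTree.size]; omega)

end StackCmd

/-! ### Functions computable in polynomial time -/

open StackCmd

/-- An encoding of the elements of `α` by binary trees.  Injectivity is not required: a function
that is computed on the level of codes respects the identifications that the encoding makes. -/
class TreeEncoding (α : Type) where
  tree : α → BinTree

open TreeEncoding

/-- The size of the encoding. -/
def treeSize {α : Type} [TreeEncoding α] (a : α) : ℕ := (tree a).size

instance : TreeEncoding BinTree := ⟨id⟩

instance : TreeEncoding Unit := ⟨fun _ => .nil⟩

instance : TreeEncoding Bool := ⟨fun b => cond b (.cons .nil .nil) .nil⟩

instance {α β : Type} [TreeEncoding α] [TreeEncoding β] : TreeEncoding (α × β) :=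
  ⟨fun p => .cons (tree p.1) (tree p.2)⟩

instance {α : Type} [TreeEncoding α] : TreeEncoding (List α) :=
  ⟨fun l => l.foldr (fun a t => .cons (tree a) t) .nil⟩

instance {α : Type} [TreeEncoding α] : TreeEncoding (Option α) :=
  ⟨fun o => o.elim .nil fun a => .cons .nil (tree a)⟩

instance {α : Type} [TreeEncoding α] (p : α → Prop) : TreeEncoding {a // p a} :=
  ⟨fun a => tree a.1⟩

section

variable {α β γ δ : Type} [TreeEncoding α] [TreeEncoding β] [TreeEncoding γ] [TreeEncoding δ]

@[simp] theorem treeSize_bool_true : treeSize true = 3 := rfl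
@[simp] theorem treeSize_bool_false : treeSize false = 1 := rfl

@[simp] theorem treeSize_prod (p : α × β) : treeSize p = treeSize p.1 + treeSize p.2 + 1 :=
  BinTree.size_cons _ _

@[simp] theorem treeSize_nil : treeSize ([] : List α) = 1 := rfl

@[simp] theorem treeSize_cons (a : α) (l : List α) :
    treeSize (a :: l) = treeSize a + treeSize l + 1 := BinTree.size_cons _ _

@[simp] theorem treeSize_none : treeSize (none : Option α) = 1 := rfl

@[simp] theorem treeSize_some (a : α) : treeSize (some a) = treeSize a + 2 := by
  have := BinTree.size_cons .nil (tree a)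
  simp only [BinTree.size_nil] at this
  simp only [treeSize] at *
  exact this.trans (by omega)

theorem treeSize_pos (a : α) : 0 < treeSize a := BinTree.size_pos _

theorem treeSize_bool_le (b : Bool) : treeSize b ≤ 3 := by cases b <;> simp

theorem treeSize_append (l l' : List α) : treeSize (l ++ l') + 1 = treeSize l + treeSize l' := by
  induction l with
  | nil => simp [add_comm]
  | cons a l ih => simp; omega

theorem length_le_treeSize (l : List α) : l.length ≤ treeSize l := by
  induction l with
  | nil => simp
  | cons a l ih => simp; omega

theorem treeSize_le_of_mem {a : α} {l : List α} (h : a ∈ l) : treeSize a ≤ treeSize l := by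
  induction l with
  | nil => simp at h
  | cons b l ih =>
    rcases List.mem_cons.1 h with rfl | h
    · simp; omega
    · have := ih h
      simp; omega

theorem polynomial_eval_mono (p : Polynomial ℕ) {a b : ℕ} (h : a ≤ b) : p.eval a ≤ p.eval b := by
  rw [Polynomial.eval_eq_sum_range, Polynomial.eval_eq_sum_range]
  gcongr

/-- `f` is computed in polynomial time by a stack program that replaces the code of the argument on
top of `main` by the code of the value and leaves everything below and the other stacks untouched.
The polynomial bounds the running time and the size of the value; it is the same for all input
alphabets `I`, which occur only in the type of the stack `input`. -/
@[fun_prop]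
def PolyTime (f : α → β) : Prop :=
  ∃ p : Polynomial ℕ, (∀ a, treeSize (f a) ≤ p.eval (treeSize a)) ∧
    ∀ I : Type, ∃ c : Program I, ∀ a inp out M A,
      Does c (stk inp out ((tree a).word ++ M) A [] [])
        (stk inp out ((tree (f a)).word ++ M) A [] []) (p.eval (treeSize a))

namespace PolyTime

theorem exists_size {f : α → β} (hf : PolyTime f) :
    ∃ p : Polynomial ℕ, ∀ a, treeSize (f a) ≤ p.eval (treeSize a) :=
  let ⟨p, h, _⟩ := hf
  ⟨p, h⟩

/-- A function that agrees with a polynomial time function on the level of trees. -/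
theorem of_tree {α' β' : Type} [TreeEncoding α'] [TreeEncoding β'] {g : α' → β'}
    (hg : PolyTime g) {f : α → β} (r : α → α') (hr : ∀ a, tree (r a) = tree a)
    (h : ∀ a, tree (f a) = tree (g (r a))) : PolyTime f := by
  obtain ⟨p, hp, hc⟩ := hg
  refine ⟨p, fun a => ?_, fun I => ?_⟩
  · have := hp (r a)
    simpa only [treeSize, h, hr] using this
  · obtain ⟨c, hc⟩ := hc I
    refine ⟨c, fun a inp out M A => ?_⟩
    have := hc (r a) inp out M A
    simpa only [treeSize, h, hr] using this

@[fun_prop]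
theorem id : PolyTime fun a : α => a :=
  ⟨Polynomial.X, fun a => by simp, fun I => ⟨load _root_.id, fun a inp out M A v =>
    ⟨v, 1, by simpa using Nat.succ_le_of_lt (treeSize_pos a), Exec.load _ _ _⟩⟩⟩

@[fun_prop]
theorem comp {g : β → γ} {f : α → β} (hg : PolyTime g) (hf : PolyTime f) :
    PolyTime fun a => g (f a) := by
  obtain ⟨p, hp, hc⟩ := hf
  obtain ⟨q, hq, hd⟩ := hg
  refine ⟨p + q.comp p, fun a => ?_, fun I => ?_⟩
  · have h₁ := hq (f a)
    have h₂ := polynomial_eval_mono q (hp a)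
    simp only [Polynomial.eval_add, Polynomial.eval_comp]
    omega
  · obtain ⟨c, hc⟩ := hc I
    obtain ⟨d, hd⟩ := hd I
    refine ⟨seq c d, fun a inp out M A => ((hc a inp out M A).seq (hd (f a) inp out M A)).mono ?_⟩
    have h₂ := polynomial_eval_mono q (hp a)
    simp only [Polynomial.eval_add, Polynomial.eval_comp]
    omega

@[fun_prop]
theorem prodMk {f : α → β} {g : α → γ} (hf : PolyTime f) (hg : PolyTime g) :
    PolyTime fun a => (f a, g a) := by
  obtain ⟨p, hp, hc⟩ := hf
  obtain ⟨q, hq, hd⟩ := hg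
  -- Duplicating the argument takes time `21 * X + 11`, saving and restoring the first value
  -- takes `8 * p + 4` and `4 * p + 2`, and the final `put` takes one step.
  refine ⟨13 * p + q + 21 * Polynomial.X + 18, fun a => ?_, fun I => ?_⟩
  · have h₁ := hp a
    have h₂ := hq a
    simp only [treeSize_prod, Polynomial.eval_add, Polynomial.eval_mul, Polynomial.eval_ofNat,
      Polynomial.eval_X]
    omega
  · obtain ⟨c, hc⟩ := hc I
    obtain ⟨d, hd⟩ := hd I
    refine ⟨seq dup <| seq c <| seq save <| seq d <| seq restore <| put .main (some true),
      fun a inp out M A => ?_⟩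
    have h₁ : Does (put .main (some true)) (stk inp out
        ((tree (f a)).word ++ ((tree (g a)).word ++ M)) A [] [])
        (stk inp out ((tree (f a, g a)).word ++ M) A [] []) 1 := by
      convert does_put_main (I := I) _ using 2
      simp [tree]
    refine ((does_dup _).seq ((hc a _ _ _ _).seq ((does_save _).seq ((hd a _ _ _ _).seq
      ((does_restore _).seq h₁))))).mono ?_
    have h₁ := hp a
    have h₂ := hq a
    simp only [Polynomial.eval_add, Polynomial.eval_mul, Polynomial.eval_ofNat,
      Polynomial.eval_X]
    simp only [treeSize] at *
    omega

/-- A function whose values are encoded by the empty tree. -/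
theorem tree_nil (f : α → β) (hf : ∀ a, tree (f a) = .nil) : PolyTime f := by
  refine ⟨12 * Polynomial.X + 7, fun a => ?_, fun I => ?_⟩
  · simp [treeSize, hf]
  · refine ⟨seq drop (put .main (some false)), fun a inp out M A => ?_⟩
    rw [hf]
    refine ((does_drop _).seq (does_put_main _)).mono ?_
    simp only [Polynomial.eval_add, Polynomial.eval_mul, Polynomial.eval_ofNat,
      Polynomial.eval_X]
    simp only [treeSize] at *
    omega

@[fun_prop]
theorem const (b : β) : PolyTime fun _ : α => b := by
  suffices ∀ t : BinTree, PolyTime fun _ : α => t from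
    (this (tree b)).of_tree (fun a => a) (fun _ => rfl) fun _ => rfl
  intro t
  induction t with
  | nil => exact tree_nil _ fun _ => rfl
  | cons s t ihs iht =>
    exact (ihs.prodMk iht).of_tree (fun a => a) (fun _ => rfl) fun _ => rfl

/-- First component of a tree that encodes a pair. -/
theorem tree_fst (f : α → β) (h : ∀ a, ∃ t, tree a = .cons (tree (f a)) t) : PolyTime f := by
  refine ⟨24 * Polynomial.X + 14, fun a => ?_, fun I => ?_⟩
  · obtain ⟨t, ht⟩ := h a
    simp [treeSize, ht]; omega
  · refine ⟨seq (fetch .main) <| seq save <| seq drop restore, fun a inp out M A => ?_⟩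
    obtain ⟨t, ht⟩ := h a
    simp only [ht, BinTree.word_cons, List.cons_append, List.append_assoc]
    refine (does_fetch_main.seq ((does_save _).seq ((does_drop _).seq (does_restore _)))).mono ?_
    simp only [Polynomial.eval_add, Polynomial.eval_mul, Polynomial.eval_ofNat,
      Polynomial.eval_X, treeSize, ht, BinTree.size_cons] at *
    omega

/-- Second component of a tree that encodes a pair. -/
theorem tree_snd (f : α → β) (h : ∀ a, ∃ t, tree a = .cons t (tree (f a))) : PolyTime f := by
  refine ⟨12 * Polynomial.X + 7, fun a => ?_, fun I => ?_⟩
  · obtain ⟨t, ht⟩ := h a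
    simp [treeSize, ht]; omega
  · refine ⟨seq (fetch .main) drop, fun a inp out M A => ?_⟩
    obtain ⟨t, ht⟩ := h a
    simp only [ht, BinTree.word_cons, List.cons_append, List.append_assoc]
    refine (does_fetch_main.seq (does_drop _)).mono ?_
    simp only [Polynomial.eval_add, Polynomial.eval_mul, Polynomial.eval_ofNat,
      Polynomial.eval_X, treeSize, ht, BinTree.size_cons] at *
    omega

@[fun_prop]
theorem fst {f : α → β × γ} (hf : PolyTime f) : PolyTime fun a => (f a).1 :=
  comp (g := Prod.fst) (tree_fst _ fun p => ⟨tree p.2, rfl⟩) hf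

@[fun_prop]
theorem snd {f : α → β × γ} (hf : PolyTime f) : PolyTime fun a => (f a).2 :=
  comp (g := Prod.snd) (tree_snd _ fun p => ⟨tree p.1, rfl⟩) hf

/-- The test whether the tree of the argument is compound. -/
theorem tree_isCons (b : α → Bool) (h : ∀ a, b a = false ↔ tree a = .nil) : PolyTime b := by
  refine ⟨24 * Polynomial.X + 20, fun a => ?_, fun I => ?_⟩
  · have := treeSize_bool_le (b a)
    simp
    omega
  · refine ⟨fetchCase .main fun v => if StackCmd.isCons v then seq drop <| seq drop <|
      seq (put .main (some false)) <| seq (put .main (some false)) (put .main (some true))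
      else put .main (some false), fun a inp out M A => ?_⟩
    cases ht : tree a with
    | nil =>
      rw [(h a).2 ht]
      simp only [BinTree.word_nil, List.cons_append, List.nil_append, treeSize, ht]
      exact (does_fetchCase_main (does_put_main _)).mono (by simp)
    | cons s t =>
      have hb : b a = true := by
        by_contra hb
        simp only [Bool.not_eq_true, h, ht] at hb
        cases hb
      rw [hb]
      simp only [BinTree.word_cons, List.cons_append, List.append_assoc]
      refine (does_fetchCase_main (b := 12 * s.size + 6 + (12 * t.size + 6 + 3)) ?_).mono ?_
      · exact (does_drop _).seq ((does_drop _).seq ((does_put_main _).seq ((does_put_main _).seq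
          (does_put_main _))))
      · simp only [Polynomial.eval_add, Polynomial.eval_mul, Polynomial.eval_ofNat,
          Polynomial.eval_X, treeSize, ht, BinTree.size_cons] at *
        omega

/-- Case distinction.  The branches are functions on subtypes, so that each of them has to be
computable only where it is used; this serves for the partial functions that take a nonempty list
or option apart. -/
theorem dite {b : α → Bool} (hb : PolyTime b) {f : {a // b a = true} → β}
    {g : {a // b a = false} → β} (hf : PolyTime f) (hg : PolyTime g) {h : α → β}
    (h₁ : ∀ a, h a.1 = f a) (h₂ : ∀ a, h a.1 = g a) : PolyTime h := by
  obtain ⟨p, hp, hc⟩ := hf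
  obtain ⟨q, hq, hd⟩ := hg
  obtain ⟨r, hr, he⟩ := hb
  refine ⟨p + q + r + 21 * Polynomial.X + 16, fun a => ?_, fun I => ?_⟩
  · simp only [Polynomial.eval_add, Polynomial.eval_mul, Polynomial.eval_ofNat, Polynomial.eval_X]
    cases hba : b a with
    | true =>
      have := hp ⟨a, hba⟩
      rw [← h₁ ⟨a, hba⟩] at this
      change _ ≤ p.eval (treeSize a) at this
      dsimp only at this
      omega
    | false =>
      have := hq ⟨a, hba⟩
      rw [← h₂ ⟨a, hba⟩] at this
      change _ ≤ q.eval (treeSize a) at this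
      dsimp only at this
      omega
  · obtain ⟨c, hc⟩ := hc I
    obtain ⟨d, hd⟩ := hd I
    obtain ⟨e, he⟩ := he I
    refine ⟨seq (seq dup e) <| fetchCase .main fun v => if StackCmd.isCons v then
      seq (fetch .main) <| seq (fetch .main) c else d, fun a inp out M A => ?_⟩
    have h₀ := (does_dup (inp := inp) (out := out) (M := M) (A := A) (tree a)).seq
      (he a inp out _ A)
    cases hba : b a with
    | true =>
      rw [hba] at h₀
      have h₃ := hc ⟨a, hba⟩ inp out M A
      rw [← h₁ ⟨a, hba⟩] at h₃
      refine (h₀.seq (b₂ := 1 + (1 + p.eval (treeSize a)) + 2) ?_).mono ?_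
      · apply does_fetchCase_main
        exact does_fetch_main.seq (does_fetch_main.seq h₃)
      simp only [Polynomial.eval_add, Polynomial.eval_mul, Polynomial.eval_ofNat,
        Polynomial.eval_X]
      simp only [treeSize]
      omega
    | false =>
      rw [hba] at h₀
      have h₃ := hd ⟨a, hba⟩ inp out M A
      rw [← h₂ ⟨a, hba⟩] at h₃
      refine (h₀.seq (b₂ := q.eval (treeSize a) + 2) ?_).mono ?_
      · apply does_fetchCase_main
        exact h₃
      simp only [Polynomial.eval_add, Polynomial.eval_mul, Polynomial.eval_ofNat,
        Polynomial.eval_X]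
      simp only [treeSize]
      omega

theorem subtype_val {p : α → Prop} : PolyTime fun a : {a // p a} => a.1 :=
  (PolyTime.id (α := α)).of_tree (fun a => a.1) (fun _ => rfl) fun _ => rfl

@[fun_prop]
theorem ite {b : α → Bool} {f g : α → β} (hb : PolyTime b) (hf : PolyTime f) (hg : PolyTime g) :
    PolyTime fun a => if b a = true then f a else g a :=
  hb.dite (f := fun a => f a.1) (g := fun a => g a.1) (hf.comp subtype_val) (hg.comp subtype_val)
    (fun a => by simp [a.2]) fun a => by simp [a.2]

@[fun_prop]
theorem cond {b : α → Bool} {f g : α → β} (hb : PolyTime b) (hf : PolyTime f) (hg : PolyTime g) :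
    PolyTime fun a => bif b a then f a else g a := by
  simpa only [cond_eq_ite] using hb.ite hf hg

@[fun_prop]
theorem not {b : α → Bool} (hb : PolyTime b) : PolyTime fun a => !b a := by
  convert hb.ite (const false) (const true) using 2 with a
  cases b a <;> rfl

@[fun_prop]
theorem and {b c : α → Bool} (hb : PolyTime b) (hc : PolyTime c) :
    PolyTime fun a => b a && c a := by
  convert hb.ite hc (const false) using 2 with a
  cases b a <;> rfl

@[fun_prop]
theorem or {b c : α → Bool} (hb : PolyTime b) (hc : PolyTime c) : PolyTime fun a => b a || c a := by
  convert hb.ite (const true) hc using 2 with a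
  cases b a <;> rfl

@[fun_prop]
theorem list_cons {f : α → β} {g : α → List β} (hf : PolyTime f) (hg : PolyTime g) :
    PolyTime fun a => f a :: g a :=
  (hf.prodMk hg).of_tree (fun a => a) (fun _ => rfl) fun _ => rfl

@[fun_prop]
theorem optionSome {f : α → β} (hf : PolyTime f) : PolyTime fun a => Option.some (f a) :=
  ((const ()).prodMk hf).of_tree (fun a => a) (fun _ => rfl) fun _ => rfl

@[fun_prop]
theorem isEmpty {l : α → List β} (hl : PolyTime l) : PolyTime fun a => (l a).isEmpty :=
  (comp (g := fun l : List β => !l.isEmpty) (tree_isCons _ fun l => by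
    cases l <;> simp [tree]) hl).not.of_tree (fun a => a) (fun _ => rfl) fun _ => by simp

/-- Case distinction on a list. -/
theorem listCases {l : α → List β} (hl : PolyTime l) {f : α → γ} {g : α → β → List β → γ}
    (hf : PolyTime f) (hg : PolyTime fun p : α × β × List β => g p.1 p.2.1 p.2.2) {h : α → γ}
    (h₁ : ∀ a, l a = [] → h a = f a) (h₂ : ∀ a b t, l a = b :: t → h a = g a b t) :
    PolyTime h := by
  have hne : ∀ a : {a // (l a).isEmpty = false}, l a.1 ≠ [] := fun a h => by
    have := a.2
    simp [h] at this
  refine hl.isEmpty.dite (f := fun a => f a.1) (g := fun a => g a.1 ((l a.1).head (hne a))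
    (l a.1).tail) (hf.comp subtype_val) ?_ (fun a => h₁ _ (by simpa using a.2)) fun a => ?_
  · refine comp (f := fun a : {a // (l a).isEmpty = false} =>
      (a.1, (l a.1).head (hne a), (l a.1).tail)) hg ?_
    refine (subtype_val.prodMk (hl.comp subtype_val)).of_tree (fun a => a) (fun _ => rfl)
      fun a => ?_
    change BinTree.cons _ (.cons _ _) = .cons _ (tree (l a.1))
    exact congrArg _ (congrArg tree (List.cons_head_tail (hne a)))
  · exact h₂ _ _ _ (List.cons_head_tail (hne a)).symm

/-- Case distinction on an option. -/
theorem optionElim {o : α → Option β} (ho : PolyTime o) {f : α → γ} {g : α → β → γ}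
    (hf : PolyTime f) (hg : PolyTime fun p : α × β => g p.1 p.2) :
    PolyTime fun a => (o a).elim (f a) (g a) := by
  have hb : PolyTime fun a => (o a).isSome :=
    comp (g := Option.isSome) (tree_isCons _ fun o => by cases o <;> simp [tree]) ho
  refine hb.dite (f := fun a => g a.1 ((o a.1).get a.2)) (g := fun a => f a.1) ?_
    (hf.comp subtype_val) (fun a => ?_) fun a => ?_
  · refine comp (f := fun a : {a // (o a).isSome = true} => (a.1, (o a.1).get a.2)) hg ?_
    refine subtype_val.prodMk (comp (g := fun o : {o : Option β // o.isSome} => o.1.get o.2)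
      (f := fun a : {a // (o a).isSome = true} => ⟨o a.1, a.2⟩)
      (tree_snd _ fun o => ⟨.nil, ?_⟩) ?_)
    · obtain ⟨_ | b, ho⟩ := o
      · simp at ho
      · rfl
    · exact (ho.comp subtype_val).of_tree (fun a => a) (fun _ => rfl) fun _ => rfl
  · obtain ⟨a, ha⟩ := a
    obtain ⟨b, hb⟩ := Option.isSome_iff_exists.1 ha
    simp [hb]
  · obtain ⟨a, ha⟩ := a
    simp only [Option.isSome_eq_false_iff, Option.isNone_iff_eq_none] at ha
    simp [ha]

end PolyTime
end

/-! ### Loops and lists -/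

section

variable {α β γ δ : Type} [TreeEncoding α] [TreeEncoding β] [TreeEncoding γ] [TreeEncoding δ]

namespace PolyTime

/-- The machine loop behind `PolyTime.iterate`: one pass deletes an element of the list and applies
`g` to the state below it. -/
theorem does_iterateLoop {I : Type} {g : α → α} {c : Program I} {p : Polynomial ℕ}
    (hc : ∀ a inp out M A, Does c (stk inp out ((tree a).word ++ M) A [] [])
      (stk inp out ((tree (g a)).word ++ M) A [] []) (p.eval (treeSize a)))
    {inp : List I} {out : List Bool} {M A : List (Option Bool)} {K Q : ℕ} (l : List β) (a : α)
    (hK : treeSize l ≤ K) (hQ : ∀ i ≤ l.length, treeSize (g^[i] a) ≤ Q) :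
    Does (fetchLoop .main StackCmd.isCons fun _ => seq drop <| seq save <| seq c restore)
      (stk inp out ((tree l).word ++ ((tree a).word ++ M)) A [] [])
      (stk inp out ((tree (g^[l.length] a)).word ++ M) A [] [])
      (l.length * (24 * K + 15 + p.eval Q) + 2) := by
  induction l generalizing a with
  | nil =>
    refine (does_fetchLoop_done (by rfl) (update_stk_main _)).mono (by simp)
  | cons b l ih =>
    have hb : treeSize b ≤ K := by simp at hK; omega
    have hl : treeSize l ≤ K := by simp at hK; omega
    have hp : p.eval (treeSize a) ≤ p.eval Q :=
      polynomial_eval_mono p (by simpa using hQ 0 (Nat.zero_le _))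
    have h := ih (g a) hl fun i hi => by
      simpa only [Function.iterate_succ_apply] using hQ (i + 1) (by simpa using hi)
    refine (does_fetchLoop_step (b₁ := 24 * K + 12 + p.eval Q) (S₁ := stk inp out
      ((tree l).word ++ ((tree (g a)).word ++ M)) A [] []) (by rfl) ?_ h).mono ?_
    · rw [update_stk_main]
      have ht : (stk inp out ((tree (b :: l)).word ++ ((tree a).word ++ M)) A [] []
          StackName.main).tail = (tree b).word ++ ((tree l).word ++ ((tree a).word ++ M)) := by
        change ((BinTree.cons (tree b) (tree l)).word ++ _).tail = _
        simp
      rw [ht]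
      refine ((does_drop _).seq ((does_save _).seq ((hc a _ _ _ _).seq
        (does_restore _)))).mono ?_
      simp only [treeSize] at *
      omega
    · simp only [List.length_cons, Nat.succ_mul]
      omega

/-- Iterating a polynomial time function as many times as a list has elements, provided that the
intermediate values stay polynomially bounded. -/
theorem iterate {g : α → α} (hg : PolyTime g) {l : γ → List β} (hl : PolyTime l) {s : γ → α}
    (hs : PolyTime s) (q : Polynomial ℕ)
    (hq : ∀ c, ∀ i ≤ (l c).length, treeSize (g^[i] (s c)) ≤ q.eval (treeSize c)) :
    PolyTime fun c => g^[(l c).length] (s c) := by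
  obtain ⟨p, -, hp⟩ := hg
  obtain ⟨r, hr⟩ := hl.exists_size
  obtain ⟨t, -, ht⟩ := hl.prodMk hs
  refine ⟨t + r * (24 * r + 15 + p.comp q) + q + 3, fun c => ?_, fun I => ?_⟩
  · have := hq c _ le_rfl
    simp only [Polynomial.eval_add, Polynomial.eval_mul, Polynomial.eval_ofNat]
    omega
  · obtain ⟨cg, hcg⟩ := hp I
    obtain ⟨cp, hcp⟩ := ht I
    refine ⟨seq cp <| seq (fetch .main) <|
      fetchLoop .main StackCmd.isCons fun _ => seq drop <| seq save <| seq cg restore,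
      fun c inp out M A => ?_⟩
    have h₁ := hcp c inp out M A
    have h₂ : (tree (l c, s c)).word ++ M =
        some true :: ((tree (l c)).word ++ ((tree (s c)).word ++ M)) := by
      change (BinTree.cons _ _).word ++ M = _
      simp
    rw [h₂] at h₁
    refine (h₁.seq (does_fetch_main.seq (does_iterateLoop hcg (l c) (s c) (hr c) (hq c)))).mono ?_
    have h₃ : (l c).length * (24 * r.eval (treeSize c) + 15 + p.eval (q.eval (treeSize c))) ≤
        r.eval (treeSize c) * (24 * r.eval (treeSize c) + 15 + p.eval (q.eval (treeSize c))) :=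
      Nat.mul_le_mul_right _ ((length_le_treeSize _).trans (hr c))
    simp only [Polynomial.eval_add, Polynomial.eval_mul, Polynomial.eval_ofNat,
      Polynomial.eval_comp]
    omega

/-- Folds whose state grows in each step by a polynomial in the size of the context only.  Growth
is measured by a function `μ` that bounds the size polynomially, and the growth condition has to
hold for the states that satisfy an invariant. -/
theorem foldl_of_measure {step : γ → δ → α → δ}
    (hstep : PolyTime fun p : γ × δ × α => step p.1 p.2.1 p.2.2) {l : γ → List α}
    (hl : PolyTime l) {s : γ → δ} (hs : PolyTime s) (Inv : γ → δ → Prop) (μ : δ → ℕ)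
    (v u q : Polynomial ℕ) (hv : ∀ d, treeSize d ≤ v.eval (μ d))
    (h₀ : ∀ c, Inv c (s c)) (hu : ∀ c, μ (s c) ≤ u.eval (treeSize c))
    (h : ∀ c d a, a ∈ l c → Inv c d →
      Inv c (step c d a) ∧ μ (step c d a) ≤ μ d + q.eval (treeSize c)) :
    PolyTime fun c => (l c).foldl (step c) (s c) := by
  -- The iterated function consumes one element of the list that is kept in the state.
  let g : γ × δ × List α → γ × δ × List α := fun p =>
    match p.2.2 with
    | [] => p
    | a :: t => (p.1, step p.1 p.2.1 a, t)
  have hg : PolyTime g := by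
    refine listCases (l := fun p : γ × δ × List α => p.2.2)
      (g := fun p a t => (p.1, step p.1 p.2.1 a, t)) (by fun_prop) PolyTime.id ?_
      (fun p hp => by simp [g, hp]) fun p a t hp => by simp [g, hp]
    have := hstep.comp (f := fun p : (γ × δ × List α) × α × List α => (p.1.1, p.1.2.1, p.2.1))
      (by fun_prop)
    exact prodMk (by fun_prop) (prodMk this (by fun_prop))
  have hstate : ∀ (c : γ) (t : List α) (i : ℕ) (d : δ), g^[i] (c, d, t) =
      (c, (t.take i).foldl (step c) d, t.drop i) := by
    intro c t i
    induction i generalizing t with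
    | zero => simp
    | succ i ih =>
      intro d
      cases t with
      | nil => simpa [g] using ih [] d
      | cons a t => simpa [g] using ih t (step c d a)
  have hfold : ∀ (c : γ) (t : List α), (∀ a ∈ t, a ∈ l c) → ∀ d, Inv c d →
      μ (t.foldl (step c) d) ≤ μ d + t.length * q.eval (treeSize c) := by
    intro c t
    induction t with
    | nil => simp
    | cons a t ih =>
      intro ht d hd
      obtain ⟨h₁, h₂⟩ := h c d a (ht a List.mem_cons_self) hd
      have := ih (fun b hb => ht b (List.mem_cons_of_mem _ hb)) _ h₁
      simp only [List.foldl_cons, List.length_cons, Nat.succ_mul]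
      omega
  have hdrop : ∀ (t : List α) (i : ℕ), treeSize (t.drop i) ≤ treeSize t := by
    intro t i
    induction i generalizing t with
    | zero => simp
    | succ i ih =>
      cases t with
      | nil => simp
      | cons a t =>
        have := ih t
        simp only [List.drop_succ_cons, treeSize_cons]
        omega
  obtain ⟨r, hr⟩ := hl.exists_size
  have key := iterate hg hl (s := fun c => (c, s c, l c)) (by fun_prop)
    (Polynomial.X + v.comp (u + r * q) + r + 2) fun c i _ => by
      rw [hstate]
      have h₁ := hfold c ((l c).take i) (fun a ha => List.mem_of_mem_take ha) _ (h₀ c)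
      have h₂ := hdrop (l c) i
      have h₃ := hr c
      have h₄ := hu c
      have h₅ : ((l c).take i).length * q.eval (treeSize c) ≤
          r.eval (treeSize c) * q.eval (treeSize c) :=
        Nat.mul_le_mul_right _ ((List.length_take_le' _ _).trans ((length_le_treeSize _).trans h₃))
      have h₆ := (hv _).trans (polynomial_eval_mono v
        (h₁.trans (Nat.add_le_add h₄ h₅)))
      simp only [treeSize_prod, Polynomial.eval_add, Polynomial.eval_mul, Polynomial.eval_ofNat,
        Polynomial.eval_X, Polynomial.eval_comp]
      omega
  convert key.snd.fst using 2 with c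
  rw [hstate]
  simp

/-- The case of `foldl_of_measure` where growth is measured by the size of the encoding. -/
theorem foldl_of_invariant {step : γ → δ → α → δ}
    (hstep : PolyTime fun p : γ × δ × α => step p.1 p.2.1 p.2.2) {l : γ → List α}
    (hl : PolyTime l) {s : γ → δ} (hs : PolyTime s) (Inv : γ → δ → Prop) (q : Polynomial ℕ)
    (h₀ : ∀ c, Inv c (s c))
    (h : ∀ c d a, a ∈ l c → Inv c d →
      Inv c (step c d a) ∧ treeSize (step c d a) ≤ treeSize d + q.eval (treeSize c)) :
    PolyTime fun c => (l c).foldl (step c) (s c) := by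
  obtain ⟨u, hu⟩ := hs.exists_size
  exact foldl_of_measure hstep hl hs Inv treeSize Polynomial.X u q (fun d => by simp) h₀ hu h

theorem foldl {step : γ → δ → α → δ}
    (hstep : PolyTime fun p : γ × δ × α => step p.1 p.2.1 p.2.2) {l : γ → List α}
    (hl : PolyTime l) {s : γ → δ} (hs : PolyTime s) (q : Polynomial ℕ)
    (h : ∀ c d a, treeSize (step c d a) ≤ treeSize d + q.eval (treeSize c + treeSize a)) :
    PolyTime fun c => (l c).foldl (step c) (s c) := by
  obtain ⟨r, hr⟩ := hl.exists_size
  refine foldl_of_invariant hstep hl hs (fun _ _ => True) (q.comp (Polynomial.X + r))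
    (fun _ => trivial) fun c d a ha _ => ⟨trivial, (h c d a).trans ?_⟩
  simp only [Polynomial.eval_comp, Polynomial.eval_add, Polynomial.eval_X]
  gcongr
  exact polynomial_eval_mono q (Nat.add_le_add_left ((treeSize_le_of_mem ha).trans (hr c)) _)

@[fun_prop]
theorem reverse {l : γ → List α} (hl : PolyTime l) : PolyTime fun c => (l c).reverse := by
  have := foldl (step := fun (_ : γ) (t : List α) a => a :: t) (by fun_prop) hl
    (const ([] : List α)) (Polynomial.X + 1) fun c d a => by simp; omega
  convert this using 2 with c
  simp

theorem foldr {step : γ → α → δ → δ}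
    (hstep : PolyTime fun p : γ × α × δ => step p.1 p.2.1 p.2.2) {l : γ → List α}
    (hl : PolyTime l) {s : γ → δ} (hs : PolyTime s) (q : Polynomial ℕ)
    (h : ∀ c a d, treeSize (step c a d) ≤ treeSize d + q.eval (treeSize c + treeSize a)) :
    PolyTime fun c => (l c).foldr (step c) (s c) := by
  have h₁ : PolyTime fun p : γ × δ × α => step p.1 p.2.2 p.2.1 :=
    hstep.comp (f := fun p : γ × δ × α => (p.1, p.2.2, p.2.1)) (by fun_prop)
  have := foldl (step := fun c d a => step c a d) h₁ hl.reverse hs q fun c d a => h c a d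
  simpa only [List.foldl_reverse] using this

@[fun_prop]
theorem append {l l' : γ → List α} (hl : PolyTime l) (hl' : PolyTime l') :
    PolyTime fun c => l c ++ l' c := by
  have := foldr (step := fun (_ : γ) a (t : List α) => a :: t) (by fun_prop) hl hl'
    (Polynomial.X + 1) fun c d a => by simp; omega
  convert this using 2 with c
  simp

theorem map {f : γ → α → β} (hf : PolyTime fun p : γ × α => f p.1 p.2) {l : γ → List α}
    (hl : PolyTime l) : PolyTime fun c => (l c).map (f c) := by
  obtain ⟨p, hp⟩ := hf.exists_size
  have h₁ : PolyTime fun p : γ × α × List β => f p.1 p.2.1 :=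
    hf.comp (f := fun p : γ × α × List β => (p.1, p.2.1)) (by fun_prop)
  have := foldr (step := fun c a t => f c a :: t) (h₁.list_cons (by fun_prop)) hl
    (const ([] : List β)) (p.comp (Polynomial.X + 1) + 1) fun c a d => by
      have := hp (c, a)
      simp only [treeSize_prod] at this
      simp
      omega
  convert this using 2 with c
  induction l c <;> simp_all

theorem flatMap {f : γ → α → List β} (hf : PolyTime fun p : γ × α => f p.1 p.2) {l : γ → List α}
    (hl : PolyTime l) : PolyTime fun c => (l c).flatMap (f c) := by
  obtain ⟨p, hp⟩ := hf.exists_size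
  have h₁ : PolyTime fun p : γ × α × List β => f p.1 p.2.1 :=
    hf.comp (f := fun p : γ × α × List β => (p.1, p.2.1)) (by fun_prop)
  have := foldr (step := fun c a t => f c a ++ t) (h₁.append (by fun_prop)) hl
    (const ([] : List β)) (p.comp (Polynomial.X + 1)) fun c a d => by
      have h₂ := hp (c, a)
      have h₃ := treeSize_append (f c a) d
      simp only [treeSize_prod] at h₂
      simp
      omega
  convert this using 2 with c
  induction l c <;> simp_all

theorem filter {f : γ → α → Bool} (hf : PolyTime fun p : γ × α => f p.1 p.2) {l : γ → List α}
    (hl : PolyTime l) : PolyTime fun c => (l c).filter (f c) := by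
  have := flatMap (f := fun c a => if f c a = true then [a] else []) (hf.ite
    (list_cons (by fun_prop) (by fun_prop)) (by fun_prop)) hl
  convert this using 2 with c
  induction l c with
  | nil => rfl
  | cons a t ih =>
    by_cases h : f c a = true <;> simp [h, ih]

theorem any {f : γ → α → Bool} (hf : PolyTime fun p : γ × α => f p.1 p.2) {l : γ → List α}
    (hl : PolyTime l) : PolyTime fun c => (l c).any (f c) := by
  convert (filter hf hl).isEmpty.not using 2 with c
  induction l c with
  | nil => rfl
  | cons a t ih => by_cases h : f c a = true <;> simp [h, ih]

theorem all {f : γ → α → Bool} (hf : PolyTime fun p : γ × α => f p.1 p.2) {l : γ → List α}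
    (hl : PolyTime l) : PolyTime fun c => (l c).all (f c) := by
  convert (any (f := fun c a => !f c a) hf.not hl).not using 2 with c
  induction l c <;> simp_all

@[fun_prop]
theorem tail {l : γ → List α} (hl : PolyTime l) : PolyTime fun c => (l c).tail :=
  listCases hl (f := fun _ => []) (g := fun _ _ t => t) (by fun_prop) (by fun_prop)
    (fun c hc => by simp [hc]) fun c a t hc => by simp [hc]

@[fun_prop]
theorem headD {l : γ → List α} (hl : PolyTime l) {d : γ → α} (hd : PolyTime d) :
    PolyTime fun c => (l c).headD (d c) :=
  listCases hl (g := fun _ a _ => a) hd (by fun_prop) (fun c hc => by simp [hc])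
    fun c a t hc => by simp [hc]

@[fun_prop]
theorem getD {l : γ → List α} (hl : PolyTime l) {d : γ → α} (hd : PolyTime d) (i : ℕ) :
    PolyTime fun c => (l c).getD i (d c) := by
  induction i generalizing l with
  | zero =>
    convert hl.headD hd using 2 with c
    cases l c <;> rfl
  | succ i ih =>
    convert ih hl.tail using 2 with c
    cases l c <;> simp

@[fun_prop]
theorem tails {l : γ → List α} (hl : PolyTime l) : PolyTime fun c => (l c).tails := by
  obtain ⟨r, hr⟩ := hl.exists_size
  -- The state consists of the current suffix and the longer ones, in reverse.
  let step : γ → List α × List (List α) → α → List α × List (List α) := fun _ p _ =>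
    if p.1.isEmpty = true then p else (p.1.tail, p.1 :: p.2)
  have h := foldl_of_invariant (step := step) (ite (by fun_prop) (by fun_prop) (by fun_prop)) hl
    (s := fun c => (l c, [])) (by fun_prop) (fun c p => treeSize p.1 ≤ r.eval (treeSize c)) (r + 1)
    hr fun c p a _ hp => by
      obtain ⟨_ | ⟨b, t⟩, u⟩ := p
      · exact ⟨hp, by simp [step]⟩
      · simp only [step, List.isEmpty_cons, treeSize_prod, treeSize_cons, List.tail_cons,
          Bool.false_eq_true, if_false, Polynomial.eval_add, Polynomial.eval_one] at hp ⊢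
        omega
  have key : ∀ (c : γ) (u t : List α) (w : List (List α)), u.length = t.length →
      (u.foldl (step c) (t, w)).2.reverse ++ [[]] = w.reverse ++ t.tails := by
    intro c u
    induction u with
    | nil =>
      intro t w ht
      obtain rfl : t = [] := List.length_eq_zero_iff.1 ht.symm
      simp
    | cons a u ih =>
      intro t w ht
      cases t with
      | nil => simp at ht
      | cons b t => simpa [step] using ih t ((b :: t) :: w) (by simpa using ht)
  convert h.snd.reverse.append (const [[]]) using 2 with c
  simpa using (key c (l c) (l c) [] rfl).symm

@[fun_prop]
theorem list_replicate_length {l : γ → List α} (hl : PolyTime l) {b : γ → β} (hb : PolyTime b) :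
    PolyTime fun c => List.replicate (l c).length (b c) := by
  convert map (f := fun c (_ : α) => b c) (by fun_prop) hl using 2 with c
  simp

/-- Case distinction on a number, given in unary, that is bounded by a constant. -/
theorem lengthCases (n : ℕ) {f : ℕ → γ → β} (hf : ∀ i, PolyTime (f i)) {x : γ → List Unit}
    (hx : PolyTime x) (hn : ∀ c, (x c).length ≤ n) : PolyTime fun c => f (x c).length c := by
  induction n generalizing f x with
  | zero =>
    convert hf 0 using 2 with c
    rw [Nat.le_zero.1 (hn c)]
  | succ n ih =>
    convert hx.isEmpty.ite (hf 0) (ih (f := fun i => f (i + 1)) (fun i => hf _) hx.tail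
      fun c => ?_) using 2 with c
    · cases h : x c <;> simp
    · have := hn c
      simp
      omega

end PolyTime

/-- Elements of a finite type are encoded by their number in an enumeration, in unary.  A number in
unary is a list, which can be taken apart by `PolyTime.listCases`. -/
@[reducible]
noncomputable def TreeEncoding.ofFintype (α : Type) [Fintype α] : TreeEncoding α :=
  ⟨fun a => tree (List.replicate (Fintype.equivFin α a) ())⟩

/-- Case distinction on an element of a finite type. -/
theorem PolyTime.fintypeCases {α : Type} [Fintype α] [Nonempty α] {f : α → γ → β}
    (hf : ∀ a, PolyTime (f a)) {x : γ → α} (hx : @PolyTime γ α _ (TreeEncoding.ofFintype α) x) :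
    PolyTime fun c => f (x c) c := by
  let e := Fintype.equivFin α
  let g : ℕ → α := fun i =>
    if h : i < Fintype.card α then e.symm ⟨i, h⟩ else Classical.arbitrary α
  have hg : ∀ a, g (e a) = a := fun a => by simp [g]
  have := PolyTime.lengthCases (Fintype.card α) (f := fun i => f (g i)) (fun i => hf _)
    (x := fun c => List.replicate (e (x c)) ())
    (@PolyTime.of_tree γ (List Unit) _ _ γ α _ (TreeEncoding.ofFintype α) x hx _ (fun c => c)
      (fun _ => rfl) fun _ => rfl) fun c => by simp
  simpa [hg] using this

/-- Every function on a finite type is computable in polynomial time. -/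
theorem PolyTime.of_fintype {α : Type} [Fintype α] [Nonempty α] (f : α → β) :
    @PolyTime α β (TreeEncoding.ofFintype α) _ f :=
  letI := TreeEncoding.ofFintype α
  PolyTime.fintypeCases (f := fun a _ => f a) (fun a => PolyTime.const (f a)) PolyTime.id

end

/-! ### Machines -/

/-- Push a word on `main` such that its first symbol is on top. -/
def StackCmd.putWord {I : Type} : List (Option Bool) → Program I
  | [] => load id
  | x :: l => seq (putWord l) (put .main x)

theorem StackCmd.does_putWord {I : Type} {inp : List I} {out : List Bool}
    {M A B C : List (Option Bool)} (l : List (Option Bool)) :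
    Does (putWord l) (stk inp out M A B C) (stk inp out (l ++ M) A B C) (l.length + 1) := by
  induction l with
  | nil => exact fun v => ⟨v, 1, le_rfl, Exec.load _ _ _⟩
  | cons x l ih => exact (ih.seq (does_put_main x)).mono (by simp)

/-- Run `f` for the input letter in the register. -/
def StackCmd.inputCase {I : Type} (f : I → Program I) : StackRegister I → Program I
  | some (.inl i) => f i
  | _ => load id

/-- Read the input, and put the tree of its reversal on top of the tree on `main`. -/
def StackCmd.readInput {I : Type} [TreeEncoding I] : Program I :=
  fetchLoop .input Option.isSome <| inputCase fun i => putWord (some true :: (tree i).word)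

theorem StackCmd.does_readInput {I : Type} [TreeEncoding I] {out : List Bool}
    {M A B C : List (Option Bool)} (K : ℕ) (hK : ∀ i : I, treeSize i ≤ K) (w l : List I) :
    Does readInput (stk w out ((tree l).word ++ M) A B C)
      (stk [] out ((tree (w.reverse ++ l)).word ++ M) A B C) (w.length * (K + 5) + 2) := by
  induction w generalizing l with
  | nil => exact (does_fetchLoop_done (by rfl) (update_stk_input _)).mono (by simp)
  | cons i w ih =>
    have h := ih (i :: l)
    simp only [List.reverse_cons, List.append_assoc, List.singleton_append]
    refine (does_fetchLoop_step (b₁ := K + 2) (by rfl) ?_ h).mono ?_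
    · rw [update_stk_input]
      have hw := does_putWord (I := I) (inp := w) (out := out) (M := (tree l).word ++ M) (A := A)
        (B := B) (C := C) (some true :: (tree i).word)
      have ht : (tree (i :: l)).word ++ M =
          (some true :: (tree i).word) ++ ((tree l).word ++ M) := by
        change (BinTree.cons (tree i) (tree l)).word ++ M = _
        simp
      rw [ht]
      refine hw.mono ?_
      have := hK i
      simpa [BinTree.word, treeSize, BinTree.size] using this
    · simp only [List.length_cons, Nat.succ_mul]
      omega

open Classical in
/-- A polynomial time predicate on lists of letters of a finite alphabet defines a language in P.
The predicate is stated for the reversed word because the letters that are popped from the input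
are put on top of one another. -/
theorem PolyTime.inP {I : Type} [Finite I] [TreeEncoding I] {f : List I → Bool} (hf : PolyTime f)
    (L : Language I) (hL : ∀ w, w ∈ L ↔ f w.reverse = true) : InP L := by
  have : Fintype I := Fintype.ofFinite I
  obtain ⟨K, hK⟩ : ∃ K, ∀ i : I, treeSize i ≤ K :=
    ⟨∑ i : I, treeSize i, fun i => Finset.single_le_sum (f := fun i : I => treeSize i)
      (fun _ _ => Nat.zero_le _) (Finset.mem_univ i)⟩
  obtain ⟨p, -, hp⟩ := hf
  obtain ⟨c, hc⟩ := hp I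
  -- The last command resets the register, as the halting configuration of a machine demands.
  let prog : Program I := seq (seq (put .main (some false)) <| seq readInput <| seq c <|
    fetchCase .main fun v => if StackCmd.isCons v then
      seq (fetch .main) <| seq (fetch .main) <| put .output true else put .output false) <|
    load fun _ => none
  have hsize : ∀ w : List I, treeSize w ≤ (K + 1) * w.length + 1 := by
    intro w
    induction w with
    | nil => simp
    | cons i w ih =>
      have := hK i
      simp only [treeSize_cons, List.length_cons, Nat.mul_succ]
      omega
  have hprog : ∀ w : List I, ∃ n, n ≤ w.length * (K + 5) + 10 +
      p.eval ((K + 1) * w.length + 1) ∧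
      Exec prog none (stk w [] [] [] [] []) none (stk [] [f w.reverse] [] [] [] []) n := by
    intro w
    have h₁ := does_put_main (I := I) (inp := w) (out := []) (M := []) (A := []) (B := [])
      (C := []) (some false)
    have h₂ := does_readInput (I := I) (out := []) (M := []) (A := []) (B := []) (C := []) K hK w []
    have h₃ := hc w.reverse [] [] [] []
    have h₄ := polynomial_eval_mono p ((hsize w.reverse).trans_eq (by rw [List.length_reverse]))
    have h₅ : Does (I := I) (fetchCase .main fun v => if StackCmd.isCons v then
        seq (fetch .main) <| seq (fetch .main) <| put .output true else put .output false)
        (stk [] [] ((tree (f w.reverse)).word ++ []) [] [] [])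
        (stk [] [f w.reverse] [] [] [] []) 5 := by
      cases f w.reverse with
      | true =>
        apply does_fetchCase_main
        exact does_fetch_main.seq (does_fetch_main.seq (does_put_output true))
      | false =>
        refine Does.mono (b₁ := 3) ?_ (by omega)
        apply does_fetchCase_main
        exact does_put_output false
    rw [List.append_nil w.reverse] at h₂
    obtain ⟨v', n, hn, e⟩ := (h₁.seq (h₂.seq (h₃.seq h₅))) none
    exact ⟨n + 1, by omega, e.seq (Exec.load _ _ _)⟩
  have : Finite (Option prog.Label) := by
    have := finite_label prog
    infer_instance
  have : Fintype (Option prog.Label) := Fintype.ofFinite _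
  let tm : FinTM2 :=
    { K := StackName
      k₀ := .input
      k₁ := .output
      Γ := StackAlphabet I
      Λ := Option prog.Label
      main := some prog.entry
      σ := StackRegister I
      initialState := none
      Γk₀Fin := inferInstanceAs (Fintype I)
      m := fun l => l.elim .halt (prog.code some none) }
  let time : Polynomial ℕ := Polynomial.X * Polynomial.C (K + 5) + 11 +
    p.comp (Polynomial.C (K + 1) * Polynomial.X + 1)
  have key : ∀ w : List I, ∃ n, n ≤ time.eval w.length ∧
      (flip bind tm.step)^[n] (some (initList tm w)) =
        some (haltList tm [decide (w ∈ L)]) := by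
    intro w
    obtain ⟨n, hn, e⟩ := hprog w
    -- One more step runs the code `halt` at the label `none`.
    refine ⟨n + 1, ?_, ?_⟩
    · simp only [time, Polynomial.eval_add, Polynomial.eval_mul, Polynomial.eval_X,
        Polynomial.eval_C, Polynomial.eval_ofNat, Polynomial.eval_comp, Polynomial.eval_one]
      omega
    · have h := e.iterate_step (fun l : Option prog.Label => l.elim .halt (prog.code some none))
        some none fun _ => rfl
      have h₁ : initList tm w = ⟨some (some prog.entry), none, stk w [] [] [] [] []⟩ := by
        simp only [initList]
        congr 1
        funext k
        cases k <;> rfl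
      have h₂ : haltList tm [decide (w ∈ L)] = ⟨none, none, stk [] [f w.reverse] [] [] [] []⟩ := by
        have hd : decide (w ∈ L) = f w.reverse := by simp [hL]
        rw [hd]
        simp only [haltList]
        congr 1
        funext k
        cases k <;> rfl
      rw [h₁, h₂, Function.iterate_succ_apply']
      refine (congrArg (flip bind tm.step) h).trans ?_
      rfl
  exact ⟨{ tm := tm
           inputAlphabet := Equiv.refl I
           outputAlphabet := Equiv.refl Bool
           time := time
           outputsFun := fun w =>
            { steps := (key w).choose
              evals_in_steps := by
                have h := (key w).choose_spec.2
                have hw : List.map (Equiv.refl I).invFun w = w := List.map_id w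
                exact (congrArg (fun u => (flip bind tm.step)^[(key w).choose]
                  (some (initList tm u))) hw).trans h
              steps_le_m := (key w).choose_spec.1 } }⟩

/-! ### Binary numbers -/

/-- The number with given binary digits, least significant digit first. -/
def bitsValue (l : List Bool) : ℕ := l.foldr (fun b n => b.toNat + 2 * n) 0

@[simp] theorem bitsValue_nil : bitsValue [] = 0 := rfl

@[simp] theorem bitsValue_cons (b : Bool) (l : List Bool) :
    bitsValue (b :: l) = b.toNat + 2 * bitsValue l := rfl

theorem bitsValue_append (l l' : List Bool) :
    bitsValue (l ++ l') = bitsValue l + 2 ^ l.length * bitsValue l' := by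
  induction l with
  | nil => simp
  | cons b l ih => simp [ih, pow_succ]; ring

theorem bitsValue_bits (n : ℕ) : bitsValue n.bits = n := by
  induction n using Nat.binaryRec' with
  | zero => simp
  | bit b n h ih => rw [Nat.bits_append_bit _ _ h]; simp [ih, Nat.bit_val]; ring

theorem bitsValue_ones (k : ℕ) : bitsValue (List.replicate k true) + 1 = 2 ^ k := by
  induction k with
  | zero => rfl
  | succ k ih => simp [List.replicate_succ, pow_succ]; omega

/-- The pairs of digits of two numbers, padded by zeros to a length that suffices for both.  The
elements of `x ++ y` only count the steps of the fold, so that a single fold does. -/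
def zipBits (x y : List Bool) : List (Bool × Bool) :=
  ((x ++ y).foldl (fun (s : (List Bool × List Bool) × List (Bool × Bool)) _ =>
    ((s.1.1.tail, s.1.2.tail), (s.1.1.headD false, s.1.2.headD false) :: s.2))
      ((x, y), [])).2.reverse

theorem bitsValue_tail (l : List Bool) :
    bitsValue l = (l.headD false).toNat + 2 * bitsValue l.tail := by
  cases l <;> simp

theorem zipBits_spec (x y : List Bool) : (zipBits x y).length = x.length + y.length ∧
    bitsValue ((zipBits x y).map Prod.fst) = bitsValue x ∧
    bitsValue ((zipBits x y).map Prod.snd) = bitsValue y := by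
  suffices ∀ (u x y : List Bool) (acc : List (Bool × Bool)), x.length ≤ u.length →
      y.length ≤ u.length → ∃ z : List (Bool × Bool),
        (u.foldl (fun (s : (List Bool × List Bool) × List (Bool × Bool)) _ =>
          ((s.1.1.tail, s.1.2.tail), (s.1.1.headD false, s.1.2.headD false) :: s.2))
          ((x, y), acc)).2.reverse = acc.reverse ++ z ∧ z.length = u.length ∧
        bitsValue (z.map Prod.fst) = bitsValue x ∧ bitsValue (z.map Prod.snd) = bitsValue y by
    obtain ⟨z, hz, h₀, h₁, h₂⟩ := this (x ++ y) x y [] (by simp) (by simp)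
    rw [zipBits, hz]
    exact ⟨by simpa using h₀, by simpa using h₁, by simpa using h₂⟩
  intro u
  induction u with
  | nil =>
    intro x y acc hx hy
    obtain rfl : x = [] := List.length_eq_zero_iff.1 (Nat.le_zero.1 hx)
    obtain rfl : y = [] := List.length_eq_zero_iff.1 (Nat.le_zero.1 hy)
    exact ⟨[], by simp⟩
  | cons a u ih =>
    intro x y acc hx hy
    obtain ⟨z, hz, h₀, h₁, h₂⟩ := ih x.tail y.tail ((x.headD false, y.headD false) :: acc)
      (by simp at hx ⊢; omega) (by simp at hy ⊢; omega)
    refine ⟨(x.headD false, y.headD false) :: z, ?_, by simp [h₀], ?_, ?_⟩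
    · rw [List.foldl_cons, hz]
      simp
    · rw [bitsValue_tail x, ← h₁]; rfl
    · rw [bitsValue_tail y, ← h₂]; rfl

/-- Sum of two binary numbers; the state of the fold is the carry and the reversed result. -/
def addBits (x y : List Bool) : List Bool :=
  let r := (zipBits x y).foldl (fun (s : Bool × List Bool) p =>
    (Bool.or (Bool.and p.1 p.2) (Bool.and s.1 (Bool.or p.1 p.2)),
      Bool.xor s.1 (Bool.xor p.1 p.2) :: s.2)) (false, [])
  (r.1 :: r.2).reverse

theorem addBits_spec (x y : List Bool) : (addBits x y).length = x.length + y.length + 1 ∧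
    bitsValue (addBits x y) = bitsValue x + bitsValue y := by
  suffices ∀ (z : List (Bool × Bool)) (s : Bool × List Bool),
      let r := z.foldl (fun (s : Bool × List Bool) p =>
        (Bool.or (Bool.and p.1 p.2) (Bool.and s.1 (Bool.or p.1 p.2)),
          Bool.xor s.1 (Bool.xor p.1 p.2) :: s.2)) s
      r.2.length = s.2.length + z.length ∧ bitsValue (r.1 :: r.2).reverse =
        bitsValue s.2.reverse + 2 ^ s.2.length *
          (s.1.toNat + bitsValue (z.map Prod.fst) + bitsValue (z.map Prod.snd)) by
    obtain ⟨h₀, h₁, h₂⟩ := zipBits_spec x y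
    have h := this (zipBits x y) (false, [])
    simp only [h₀, h₁, h₂] at h
    refine ⟨?_, ?_⟩
    · simp only [addBits, List.length_reverse, List.length_cons, h.1]
      simp
    · rw [addBits, h.2]
      simp
  intro z
  induction z with
  | nil => intro s; simp [bitsValue_append]
  | cons p z ih =>
    intro s
    obtain ⟨h₁, h₂⟩ := ih (Bool.or (Bool.and p.1 p.2) (Bool.and s.1 (Bool.or p.1 p.2)),
      Bool.xor s.1 (Bool.xor p.1 p.2) :: s.2)
    refine ⟨?_, ?_⟩
    · rw [List.foldl_cons, h₁]
      simp
      omega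
    · rw [List.foldl_cons, h₂]
      obtain ⟨c, acc⟩ := s
      obtain ⟨a, b⟩ := p
      simp only [List.reverse_cons, bitsValue_append, List.length_reverse, List.length_cons,
        bitsValue_cons, bitsValue_nil, List.map_cons, pow_succ]
      cases a <;> cases b <;> cases c <;> simp <;> ring

/-- Comparison of two binary numbers: the highest digits that differ decide.  Digits are visited
from the lowest to the highest, so later ones overrule earlier ones. -/
def leBits (x y : List Bool) : Bool :=
  (zipBits x y).foldl (fun r p => bif Bool.xor p.1 p.2 then p.2 else r) true

theorem leBits_iff (x y : List Bool) : leBits x y = true ↔ bitsValue x ≤ bitsValue y := by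
  suffices ∀ (z : List (Bool × Bool)) (r : Bool),
      z.foldl (fun r p => bif Bool.xor p.1 p.2 then p.2 else r) r = true ↔
        bitsValue (z.map Prod.fst) < bitsValue (z.map Prod.snd) + r.toNat by
    obtain ⟨-, h₁, h₂⟩ := zipBits_spec x y
    rw [leBits, this, h₁, h₂, Bool.toNat_true, Nat.lt_succ_iff]
  intro z
  induction z with
  | nil => intro r; cases r <;> simp
  | cons p z ih =>
    intro r
    obtain ⟨a, b⟩ := p
    rw [List.foldl_cons, ih]
    cases a <;> cases b <;> cases r <;> simp <;> omega

/-- Sum of a list of binary numbers. -/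
def sumBits (l : List (List Bool)) : List Bool := l.foldr addBits []

theorem bitsValue_sumBits (l : List (List Bool)) :
    bitsValue (sumBits l) = (l.map bitsValue).sum := by
  induction l with
  | nil => rfl
  | cons x l ih =>
    rw [List.map_cons, List.sum_cons, ← ih]
    exact (addBits_spec x (sumBits l)).2

/-- Comparison of the lengths of two lists.  A list of `k` ones has the value `2 ^ k - 1`, so
lengths can be compared as binary numbers. -/
def sameLength {α β : Type} (l : List α) (l' : List β) : Bool :=
  leBits (List.replicate l.length true) (List.replicate l'.length true) &&
    leBits (List.replicate l'.length true) (List.replicate l.length true)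

theorem sameLength_iff {α β : Type} (l : List α) (l' : List β) :
    sameLength l l' = true ↔ l.length = l'.length := by
  have h₁ := bitsValue_ones l.length
  have h₂ := bitsValue_ones l'.length
  rw [sameLength, Bool.and_eq_true, leBits_iff, leBits_iff, ← le_antisymm_iff]
  refine ⟨fun h => Nat.pow_right_injective le_rfl ?_, fun h => by rw [h]⟩
  simp only
  omega

theorem treeSize_bits_le (l : List Bool) : treeSize l ≤ 4 * l.length + 1 := by
  induction l with
  | nil => simp
  | cons b l ih =>
    have := treeSize_bool_le b
    simp
    omega

section

variable {α β γ : Type} [TreeEncoding α] [TreeEncoding β] [TreeEncoding γ]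

@[fun_prop]
theorem polyTime_xor {b c : α → Bool} (hb : PolyTime b) (hc : PolyTime c) :
    PolyTime fun a => Bool.xor (b a) (c a) := by
  convert hb.ite hc.not hc using 2 with a
  cases b a <;> simp

theorem treeSize_tail_le (l : List α) : treeSize l.tail ≤ treeSize l := by
  cases l <;> simp; omega

@[fun_prop]
theorem polyTime_zipBits {x y : α → List Bool} (hx : PolyTime x) (hy : PolyTime y) :
    PolyTime fun a => zipBits (x a) (y a) := by
  unfold zipBits
  refine PolyTime.reverse (PolyTime.snd ?_)
  refine PolyTime.foldl (step := fun (_ : α) (s : (List Bool × List Bool) ×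
    List (Bool × Bool)) (_ : Bool) => ((s.1.1.tail, s.1.2.tail),
      (s.1.1.headD false, s.1.2.headD false) :: s.2)) (by fun_prop) (hx.append hy)
      (s := fun a => ((x a, y a), [])) (by fun_prop) 8 fun c d a => ?_
  have h₁ := treeSize_tail_le d.1.1
  have h₂ := treeSize_tail_le d.1.2
  have h₃ := treeSize_bool_le (d.1.1.headD false)
  have h₄ := treeSize_bool_le (d.1.2.headD false)
  simp only [treeSize_prod, treeSize_cons, Polynomial.eval_ofNat]
  omega

@[fun_prop]
theorem polyTime_addBits {x y : α → List Bool} (hx : PolyTime x) (hy : PolyTime y) :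
    PolyTime fun a => addBits (x a) (y a) := by
  unfold addBits
  have h := PolyTime.foldl (step := fun (_ : α) (s : Bool × List Bool) (p : Bool × Bool) =>
    (Bool.or (Bool.and p.1 p.2) (Bool.and s.1 (Bool.or p.1 p.2)),
      Bool.xor s.1 (Bool.xor p.1 p.2) :: s.2)) (by fun_prop) (polyTime_zipBits hx hy)
      (s := fun _ => (false, [])) (by fun_prop) 7 fun c d a => by
    have h₁ := treeSize_bool_le (Bool.or (Bool.and a.1 a.2) (Bool.and d.1 (Bool.or a.1 a.2)))
    have h₂ := treeSize_bool_le (Bool.xor d.1 (Bool.xor a.1 a.2))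
    simp only [treeSize_prod, treeSize_cons, Polynomial.eval_ofNat]
    omega
  exact (h.fst.list_cons h.snd).reverse

@[fun_prop]
theorem polyTime_leBits {x y : α → List Bool} (hx : PolyTime x) (hy : PolyTime y) :
    PolyTime fun a => leBits (x a) (y a) := by
  unfold leBits
  exact PolyTime.foldl (step := fun (_ : α) (r : Bool) (p : Bool × Bool) =>
    bif Bool.xor p.1 p.2 then p.2 else r) (by fun_prop) (polyTime_zipBits hx hy)
    (s := fun _ => true) (by fun_prop) 3 fun c d a => by
      have := treeSize_bool_le (bif Bool.xor a.1 a.2 then a.2 else d)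
      rw [Polynomial.eval_ofNat]
      omega

/-- The size of an intermediate sum is bounded through its length: an addition adds up the lengths,
whereas the tree size of the result is bounded by `4 * X + 1` in the length only, and this factor
would accumulate if growth were measured by tree size. -/
@[fun_prop]
theorem polyTime_sumBits {l : α → List (List Bool)} (hl : PolyTime l) :
    PolyTime fun a => sumBits (l a) := by
  have h : PolyTime fun p : α × List Bool × List Bool => addBits p.2.2 p.2.1 := by
    fun_prop
  have := PolyTime.foldl_of_measure (step := fun (_ : α) d x => addBits x d) h hl.reverse
    (s := fun _ => []) (by fun_prop) (fun _ _ => True) List.length (4 * Polynomial.X + 1) 0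
    (hl.exists_size.choose + 1) (fun d => by simpa using treeSize_bits_le d) (fun _ => trivial)
    (fun c => by simp) fun c d x hx _ => ⟨trivial, by
      have h₁ := hl.exists_size.choose_spec c
      have h₂ := treeSize_le_of_mem (List.mem_reverse.1 hx)
      have h₃ := length_le_treeSize x
      rw [(addBits_spec x d).1, Polynomial.eval_add, Polynomial.eval_one]
      omega⟩
  simp only [List.foldl_reverse] at this
  exact this

@[fun_prop]
theorem polyTime_sameLength {l : γ → List α} {l' : γ → List β} (hl : PolyTime l)
    (hl' : PolyTime l') : PolyTime fun c => sameLength (l c) (l' c) := by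
  unfold sameLength
  fun_prop

end

/-! ### Rankings and letters -/

section

variable {α β γ : Type} [TreeEncoding α] [TreeEncoding β] [TreeEncoding γ]

/-- A conjunction over a list that is not part of the data: the tests may differ arbitrarily. -/
theorem polyTime_all_const {ι : Type} (L : List ι) {f : ι → γ → Bool} (hf : ∀ i, PolyTime (f i)) :
    PolyTime fun c => L.all fun i => f i c := by
  induction L with
  | nil => exact PolyTime.const true
  | cons i L ih => exact (hf i).and ih

theorem polyTime_any_const {ι : Type} (L : List ι) {f : ι → γ → Bool} (hf : ∀ i, PolyTime (f i)) :
    PolyTime fun c => L.any fun i => f i c := by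
  induction L with
  | nil => exact PolyTime.const false
  | cons i L ih => exact (hf i).or ih

end

variable {m : ℕ}

/-- Preference lists: `σ i` is the candidate at position `i`. -/
abbrev Ranking (m : ℕ) : Type := Equiv.Perm (Fin (m + 1))

noncomputable instance : TreeEncoding (Ranking m) := TreeEncoding.ofFintype _

noncomputable instance : Fintype (InputSymbol m) :=
  Fintype.ofInjective (fun s : InputSymbol m => match s with
    | .bit b => (Sum.inl b : Bool ⊕ Option (Ranking m))
    | .endNum => Sum.inr none
    | .pref τ => Sum.inr (some τ)) fun s t h => by cases s <;> cases t <;> simp_all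

instance : Nonempty (InputSymbol m) := ⟨.endNum⟩

noncomputable instance : TreeEncoding (InputSymbol m) := TreeEncoding.ofFintype _

@[fun_prop]
theorem polyTime_ranking_eq {γ : Type} [TreeEncoding γ] {σ τ : γ → Ranking m} (hσ : PolyTime σ)
    (hτ : PolyTime τ) : PolyTime fun c => decide (σ c = τ c) :=
  PolyTime.fintypeCases (f := fun ρ c => decide (ρ = τ c))
    (fun ρ => (PolyTime.of_fintype fun ρ' => decide (ρ = ρ')).comp hτ) hσ

/-! ### Reading the input -/

/-- The contents of an input word: the numbers before the first voter, and for each voter the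
preference list with the numbers that follow it. -/
abbrev RawInput (m : ℕ) : Type := List (List Bool) × List (Ranking m × List (List Bool))

/-- The word with given contents. -/
def RawInput.encode (r : RawInput m) : List (InputSymbol m) :=
  r.1.flatMap (fun x => x.map .bit ++ [.endNum]) ++
    r.2.flatMap fun v => .pref v.1 :: v.2.flatMap fun x => x.map .bit ++ [.endNum]

/-- The effect of one more symbol at the front of a word on its contents.  A bit belongs to the
first number, which has to be there already: words are read from the end, where the end mark of a
number comes before its bits. -/
def parseStep (r : RawInput m) : InputSymbol m → Option (RawInput m)
  | .bit b => if r.1.isEmpty = true then none else some ((b :: r.1.headD []) :: r.1.tail, r.2)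
  | .endNum => some ([] :: r.1, r.2)
  | .pref τ => some ([], (τ, r.1) :: r.2)

/-- The contents of a word, if it is well formed. -/
def parse (w : List (InputSymbol m)) : Option (RawInput m) :=
  w.foldr (fun s o => o.elim none fun r => parseStep r s) (some ([], []))

theorem parse_cons (s : InputSymbol m) (w : List (InputSymbol m)) :
    parse (s :: w) = (parse w).elim none fun r => parseStep r s := rfl

theorem parse_number (x : List Bool) {w : List (InputSymbol m)} {r : RawInput m}
    (h : parse w = some r) : parse (x.map .bit ++ .endNum :: w) = some (x :: r.1, r.2) := by
  induction x with
  | nil => simp [parse_cons, h, parseStep]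
  | cons b x ih => simp [parse_cons, ih, parseStep]

theorem parse_numbers (l : List (List Bool)) {w : List (InputSymbol m)} {r : RawInput m}
    (h : parse w = some r) :
    parse (l.flatMap (fun x => x.map .bit ++ [.endNum]) ++ w) = some (l ++ r.1, r.2) := by
  induction l with
  | nil => simpa using h
  | cons x l ih => simpa using parse_number x ih

theorem parse_encode (r : RawInput m) : parse r.encode = some r := by
  obtain ⟨nums, vs⟩ := r
  suffices parse (vs.flatMap fun v => .pref v.1 :: v.2.flatMap fun x => x.map .bit ++ [.endNum]) =
      some ([], vs) by
    simpa [RawInput.encode] using parse_numbers nums this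
  induction vs with
  | nil => rfl
  | cons v vs ih =>
    rw [List.flatMap_cons, List.cons_append, parse_cons, parse_numbers v.2 ih]
    simp [parseStep]

theorem encode_of_parse {w : List (InputSymbol m)} {r : RawInput m} (h : parse w = some r) :
    r.encode = w := by
  induction w generalizing r with
  | nil =>
    obtain rfl : ([], []) = r := by simpa [parse] using h
    rfl
  | cons s w ih =>
    rw [parse_cons] at h
    obtain ⟨r', hr'⟩ : ∃ r', parse w = some r' := by
      cases h' : parse w with
      | none => simp [h'] at h
      | some r' => exact ⟨r', rfl⟩
    rw [hr', Option.elim_some] at h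
    rw [← ih hr']
    obtain ⟨nums, vs⟩ := r'
    cases s with
    | endNum =>
      simp only [parseStep, Option.some.injEq] at h
      subst h
      simp [RawInput.encode]
    | pref τ =>
      simp only [parseStep, Option.some.injEq] at h
      subst h
      simp [RawInput.encode]
    | bit b =>
      cases nums with
      | nil => simp [parseStep] at h
      | cons x nums =>
        simp [parseStep] at h
        subst h
        simp [RawInput.encode]

theorem polyTime_parse {γ : Type} [TreeEncoding γ] {w : γ → List (InputSymbol m)}
    (hw : PolyTime w) : PolyTime fun c => parse (w c) := by
  unfold parse
  have h : PolyTime fun p : γ × InputSymbol m × Option (RawInput m) =>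
      p.2.2.elim none fun r => parseStep r p.2.1 := by
    refine PolyTime.fintypeCases
      (f := fun s (p : γ × InputSymbol m × Option (RawInput m)) =>
        p.2.2.elim none fun r => parseStep r s) (fun s => ?_) (by fun_prop)
    refine PolyTime.optionElim (g := fun _ r => parseStep r s) (by fun_prop) (by fun_prop) ?_
    cases s <;> simp only [parseStep] <;> fun_prop
  refine PolyTime.foldr h hw (s := fun _ => some ([], [])) (by fun_prop)
    (10 + Polynomial.C (∑ τ : Ranking m, treeSize τ)) fun c s o => ?_
  simp only [Polynomial.eval_add, Polynomial.eval_ofNat, Polynomial.eval_C]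
  have hs := treeSize_pos s
  cases o with
  | none => simp
  | some r =>
    obtain ⟨nums, vs⟩ := r
    cases s with
    | bit b =>
      have hb := treeSize_bool_le b
      cases nums with
      | nil => simp [parseStep]; omega
      | cons x nums =>
        simp [parseStep]
        omega
    | endNum => simp [parseStep]; omega
    | pref τ =>
      have := Finset.single_le_sum (f := fun τ : Ranking m => treeSize τ)
        (fun _ _ => Nat.zero_le _) (Finset.mem_univ τ)
      simp [parseStep]
      omega

/-! ### The algorithm -/

/-- Equality of the values of two binary numbers. -/
def eqBits (x y : List Bool) : Bool := leBits x y && leBits y x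

/-- Whether a binary number, least significant digit first, has no leading zeros; this includes `0`,
which has no digits. -/
def isCanonical (x : List Bool) : Bool := x.reverse.headD true

/-- Whether the numbers of a voter are those of a voter with weight one and equal prices. -/
def isValidVoter (l : List (List Bool)) : Bool :=
  sameLength l (List.replicate 3 ()) && l.all isCanonical && eqBits (l.getD 0 []) [true] &&
    eqBits (l.getD 1 []) (l.getD 2 []) && !leBits (l.getD 1 []) []

/-- Whether the contents of a word are those of an instance with unit weights and symmetric prices
(for `m + 1` candidates). -/
def isValid (m : ℕ) (r : RawInput m) : Bool :=
  sameLength r.1 (List.replicate (m + 3) ()) && r.1.all isCanonical &&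
    ((List.finRange (m + 1)).all fun i => (List.finRange (m + 1)).all fun j =>
      !decide (i ≤ j) || leBits (r.1.getD j []) (r.1.getD i [])) &&
    r.2.all fun v => isValidVoter v.2

/-- What the algorithm uses of a voter: preference list, price, and a binary number that is
different for different voters and breaks ties between prices. -/
abbrev VoterData (m : ℕ) : Type := Ranking m × List Bool × List Bool

/-- The data of the voters.  Ties are broken by the number `k` of voters from the given one to the
end of the list, in the form of `k` binary digits `1`. -/
def voterData (l : List (Ranking m × List (List Bool))) : List (VoterData m) :=
  l.tails.flatMap fun t =>
    (t.take 1).map fun v => (v.1, v.2.getD 1 [], List.replicate t.length true)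

/-- `isBelow a x`: voter `a` has the same preferences as `x` and is not more expensive, and in the
case of equal prices it does not come later in the order that breaks ties. -/
def isBelow (a x : VoterData m) : Bool :=
  decide (a.1 = x.1) && (leBits a.2.1 x.2.1 && (!leBits x.2.1 a.2.1 || leBits a.2.2 x.2.2))

/-- `a` belongs to the set of voters that is generated by `X`. -/
def inDown (X : List (VoterData m)) (a : VoterData m) : Bool := X.any fun x => isBelow a x

/-- `a` is bribed: it is in the set generated by `Y`, but not in the set generated by `X`. -/
def isBribed (X Y : List (VoterData m)) (a : VoterData m) : Bool := inDown Y a && !inDown X a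

/-- The lists of at most `k` elements of `l`. -/
def shortLists {α : Type} : ℕ → List α → List (List α)
  | 0, _ => [[]]
  | k + 1, l => (shortLists k l).flatMap fun t => t :: l.map fun x => x :: t

/-- The lists that consist of blocks of equal elements, one block for each element of the first
argument; no block is longer than the second argument. -/
def blockLists {α β : Type} : List α → List β → List (List α)
  | [], _ => [[]]
  | τ :: ts, l => (blockLists ts l).flatMap fun w =>
      l.tails.map fun t => List.replicate t.length τ ++ w

/-- The score of candidate `c` when the lists in `R` are reported. -/
def scoreBits (scores : List (List Bool)) (c : Fin (m + 1)) (R : List (Ranking m)) : List Bool :=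
  sumBits (R.map fun σ => scores.getD (σ.symm c) [])

/-- The last candidate is the unique winner when the lists in `R` are reported. -/
def winsBits (m : ℕ) (scores : List (List Bool)) (R : List (Ranking m)) : Bool :=
  (List.finRange (m + 1)).all fun c =>
    decide (c = Fin.last m) || !leBits (scoreBits scores (Fin.last m) R) (scoreBits scores c R)

/-- The last candidate is beaten when the lists in `R` are reported. -/
def losesBits (m : ℕ) (scores : List (List Bool)) (R : List (Ranking m)) : Bool :=
  (List.finRange (m + 1)).any fun c =>
    !leBits (scoreBits scores c R) (scoreBits scores (Fin.last m) R)

/-- Total price of a list of voters. -/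
def costBits (l : List (VoterData m)) : List Bool := sumBits (l.map fun a => a.2.1)

/-- Whether no attack that bribes `D` and leaves the voters in `U` alone succeeds.  The reports of
the bribed voters are the block lists of the right length; `D ++ U`, the list of all voters, only
bounds the lengths of the blocks. -/
noncomputable def resists (success : List (List Bool) → List (Ranking m) → Bool)
    (scores : List (List Bool)) (D U : List (VoterData m)) : Bool :=
  (blockLists Finset.univ.toList (D ++ U)).all fun R =>
    !sameLength R D || !success scores (U.map (fun a => a.1) ++ R)

/-- The decision procedure on the contents of an input word: search for generators `X` of a set of
voters to award such that no generators `Y` lead to a successful attack. -/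
noncomputable def isProtectable (success : List (List Bool) → List (Ranking m) → Bool)
    (r : RawInput m) : Bool :=
  (shortLists (Fintype.card (Ranking m)) (voterData r.2)).any fun X =>
    leBits (costBits ((voterData r.2).filter (inDown X))) (r.1.getD (m + 1) []) &&
    (shortLists (Fintype.card (Ranking m)) (voterData r.2)).all fun Y =>
      !leBits (costBits ((voterData r.2).filter (isBribed X Y))) (r.1.getD (m + 2) []) ||
        resists success r.1 ((voterData r.2).filter (isBribed X Y))
          ((voterData r.2).filter fun a => !isBribed X Y a)

section

variable {γ : Type} [TreeEncoding γ]

theorem polyTime_isCanonical : PolyTime isCanonical := by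
  unfold isCanonical
  fun_prop

theorem polyTime_all_isCanonical {l : γ → List (List Bool)} (hl : PolyTime l) :
    PolyTime fun c => (l c).all isCanonical :=
  PolyTime.all (f := fun (_ : γ) (x : List Bool) => isCanonical x)
    (polyTime_isCanonical.comp (by fun_prop)) hl

theorem polyTime_isValidVoter : PolyTime isValidVoter := by
  unfold isValidVoter eqBits
  exact ((((by fun_prop : PolyTime fun l : List (List Bool) =>
    sameLength l (List.replicate 3 ())).and (polyTime_all_isCanonical PolyTime.id)).and
    (by fun_prop)).and (by fun_prop)).and (by fun_prop)

theorem polyTime_isValid : PolyTime (isValid m) := by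
  have h₁ : PolyTime fun r : RawInput m => sameLength r.1 (List.replicate (m + 3) ()) := by
    fun_prop
  have h₂ : PolyTime fun r : RawInput m => r.1.all isCanonical :=
    polyTime_all_isCanonical (by fun_prop)
  have h₃ : PolyTime fun r : RawInput m => r.2.all fun v => isValidVoter v.2 :=
    PolyTime.all (f := fun (_ : RawInput m) (v : Ranking m × List (List Bool)) =>
      isValidVoter v.2) (polyTime_isValidVoter.comp (by fun_prop)) (by fun_prop)
  have h₄ : PolyTime fun r : RawInput m => (List.finRange (m + 1)).all fun i =>
      (List.finRange (m + 1)).all fun j =>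
        !decide (i ≤ j) || leBits (r.1.getD j []) (r.1.getD i []) :=
    polyTime_all_const _ fun i => polyTime_all_const _ fun j => by fun_prop
  exact ((h₁.and h₂).and h₄).and h₃

@[fun_prop]
theorem polyTime_voterData {l : γ → List (Ranking m × List (List Bool))} (hl : PolyTime l) :
    PolyTime fun c => voterData (l c) := by
  unfold voterData
  refine PolyTime.flatMap (f := fun (_ : γ) (t : List (Ranking m × List (List Bool))) =>
    (t.take 1).map fun v => (v.1, v.2.getD 1 [], List.replicate t.length true)) ?_ hl.tails
  refine PolyTime.listCases (l := fun p : γ × List (Ranking m × List (List Bool)) => p.2)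
    (f := fun _ => []) (g := fun p v _ => [(v.1, v.2.getD 1 [], List.replicate p.2.length true)])
    (by fun_prop) (by fun_prop) (by fun_prop) (fun p hp => by simp [hp])
    fun p v t hp => by simp [hp]

@[fun_prop]
theorem polyTime_isBelow {a x : γ → VoterData m} (ha : PolyTime a) (hx : PolyTime x) :
    PolyTime fun c => isBelow (a c) (x c) := by
  unfold isBelow
  fun_prop

@[fun_prop]
theorem polyTime_inDown {X : γ → List (VoterData m)} {a : γ → VoterData m} (hX : PolyTime X)
    (ha : PolyTime a) : PolyTime fun c => inDown (X c) (a c) :=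
  PolyTime.any (f := fun (c : γ) (x : VoterData m) => isBelow (a c) x) (by fun_prop) hX

@[fun_prop]
theorem polyTime_isBribed {X Y : γ → List (VoterData m)} {a : γ → VoterData m} (hX : PolyTime X)
    (hY : PolyTime Y) (ha : PolyTime a) : PolyTime fun c => isBribed (X c) (Y c) (a c) := by
  unfold isBribed
  fun_prop

@[fun_prop]
theorem polyTime_shortLists {α : Type} [TreeEncoding α] (k : ℕ) {l : γ → List α}
    (hl : PolyTime l) : PolyTime fun c => shortLists k (l c) := by
  induction k with
  | zero => exact PolyTime.const [[]]
  | succ k ih =>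
    refine PolyTime.flatMap (f := fun c (t : List α) => t :: (l c).map fun x => x :: t) ?_ ih
    refine PolyTime.list_cons (by fun_prop) ?_
    exact PolyTime.map (f := fun (p : γ × List α) x => x :: p.2) (by fun_prop) (by fun_prop)

@[fun_prop]
theorem polyTime_blockLists {α β : Type} [TreeEncoding α] [TreeEncoding β] (ts : List α)
    {l : γ → List β} (hl : PolyTime l) : PolyTime fun c => blockLists ts (l c) := by
  induction ts with
  | nil => exact PolyTime.const [[]]
  | cons τ ts ih =>
    refine PolyTime.flatMap (f := fun c (w : List α) =>
      (l c).tails.map fun t => List.replicate t.length τ ++ w) ?_ ih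
    exact PolyTime.map (f := fun (p : γ × List α) (t : List β) =>
      List.replicate t.length τ ++ p.2) (by fun_prop) (by fun_prop)

@[fun_prop]
theorem polyTime_scoreBits {scores : γ → List (List Bool)} {R : γ → List (Ranking m)}
    (hs : PolyTime scores) (hR : PolyTime R) (c : Fin (m + 1)) :
    PolyTime fun a => scoreBits (scores a) c (R a) := by
  refine polyTime_sumBits (PolyTime.map (f := fun (a : γ) (σ : Ranking m) =>
    (scores a).getD (σ.symm c) []) ?_ hR)
  exact PolyTime.fintypeCases (f := fun (σ : Ranking m) (p : γ × Ranking m) =>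
    (scores p.1).getD (σ.symm c) []) (fun σ => by fun_prop) PolyTime.id.snd

theorem polyTime_winsBits : PolyTime fun p : List (List Bool) × List (Ranking m) =>
    winsBits m p.1 p.2 :=
  polyTime_all_const _ fun c => by fun_prop

theorem polyTime_losesBits : PolyTime fun p : List (List Bool) × List (Ranking m) =>
    losesBits m p.1 p.2 :=
  polyTime_any_const _ fun c => by fun_prop

@[fun_prop]
theorem polyTime_costBits {l : γ → List (VoterData m)} (hl : PolyTime l) :
    PolyTime fun c => costBits (l c) :=
  polyTime_sumBits (PolyTime.map (f := fun (_ : γ) (a : VoterData m) => a.2.1) (by fun_prop) hl)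

theorem polyTime_resists {success : List (List Bool) → List (Ranking m) → Bool}
    (h : PolyTime fun p : List (List Bool) × List (Ranking m) => success p.1 p.2)
    {s : γ → List (List Bool)} {D U : γ → List (VoterData m)} (hs : PolyTime s) (hD : PolyTime D)
    (hU : PolyTime U) : PolyTime fun c => resists success (s c) (D c) (U c) := by
  have h₁ : PolyTime fun p : γ × List (Ranking m) => (U p.1).map fun a => a.1 :=
    PolyTime.map (f := fun _ (a : VoterData m) => a.1) (by fun_prop) (by fun_prop)
  have h₂ := h.comp (f := fun p : γ × List (Ranking m) =>
    (s p.1, (U p.1).map (fun a => a.1) ++ p.2)) (by fun_prop)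
  have h₃ : PolyTime fun p : γ × List (Ranking m) => sameLength p.2 (D p.1) := by fun_prop
  exact PolyTime.all (f := fun (c : γ) (R : List (Ranking m)) => !sameLength R (D c) ||
    !success (s c) ((U c).map (fun a => a.1) ++ R)) (h₃.not.or h₂.not) (by fun_prop)

theorem polyTime_isProtectable {success : List (List Bool) → List (Ranking m) → Bool}
    (h : PolyTime fun p : List (List Bool) × List (Ranking m) => success p.1 p.2) :
    PolyTime (isProtectable success) := by
  have h₀ : PolyTime fun p : RawInput m × List (VoterData m) => voterData p.1.2 :=
    polyTime_voterData (by fun_prop)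
  have h₁ : PolyTime fun p : (RawInput m × List (VoterData m)) × List (VoterData m) =>
      (voterData p.1.1.2).filter (isBribed p.1.2 p.2) :=
    PolyTime.filter (f := fun (p : (RawInput m × List (VoterData m)) × List (VoterData m))
      (a : VoterData m) => isBribed p.1.2 p.2 a) (by fun_prop) (by fun_prop)
  have h₂ : PolyTime fun p : (RawInput m × List (VoterData m)) × List (VoterData m) =>
      (voterData p.1.1.2).filter fun a => !isBribed p.1.2 p.2 a :=
    PolyTime.filter (f := fun (p : (RawInput m × List (VoterData m)) × List (VoterData m))
      (a : VoterData m) => !isBribed p.1.2 p.2 a) (by fun_prop) (by fun_prop)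
  have h₃ := polyTime_resists h (s := fun p : (RawInput m × List (VoterData m)) ×
    List (VoterData m) => p.1.1.1) (by fun_prop) h₁ h₂
  have h₄ : PolyTime fun p : (RawInput m × List (VoterData m)) × List (VoterData m) =>
      leBits (costBits ((voterData p.1.1.2).filter (isBribed p.1.2 p.2)))
        (p.1.1.1.getD (m + 2) []) := by fun_prop
  have h₅ : PolyTime fun p : RawInput m × List (VoterData m) =>
      (voterData p.1.2).filter (inDown p.2) :=
    PolyTime.filter (f := fun (p : RawInput m × List (VoterData m)) (a : VoterData m) =>
      inDown p.2 a) (by fun_prop) h₀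
  have h₆ : PolyTime fun p : RawInput m × List (VoterData m) =>
      leBits (costBits ((voterData p.1.2).filter (inDown p.2))) (p.1.1.getD (m + 1) []) := by
    fun_prop
  have h₇ : PolyTime fun p : RawInput m × List (VoterData m) =>
      shortLists (Fintype.card (Ranking m)) (voterData p.1.2) := by fun_prop
  have h₈ : PolyTime fun r : RawInput m =>
      shortLists (Fintype.card (Ranking m)) (voterData r.2) := by fun_prop
  have h₉ := PolyTime.all (f := fun (p : RawInput m × List (VoterData m)) Y =>
    !leBits (costBits ((voterData p.1.2).filter (isBribed p.2 Y))) (p.1.1.getD (m + 2) []) ||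
      resists success p.1.1 ((voterData p.1.2).filter (isBribed p.2 Y))
        ((voterData p.1.2).filter fun a => !isBribed p.2 Y a)) (h₄.not.or h₃) h₇
  exact PolyTime.any (f := fun (r : RawInput m) X =>
    leBits (costBits ((voterData r.2).filter (inDown X))) (r.1.getD (m + 1) []) &&
    (shortLists (Fintype.card (Ranking m)) (voterData r.2)).all fun Y =>
      !leBits (costBits ((voterData r.2).filter (isBribed X Y))) (r.1.getD (m + 2) []) ||
        resists success r.1 ((voterData r.2).filter (isBribed X Y))
          ((voterData r.2).filter fun a => !isBribed X Y a)) (h₆.and h₉) h₈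

end

/-! ### The exchange argument -/

section Exchange

variable {J T : Type} [DecidableEq T]

/-- Number of elements of type `τ`. -/
def typeCount (t : J → T) (S : Finset J) (τ : T) : ℕ := (S.filter fun j => t j = τ).card

/-- A set of voters that contains with a voter all cheaper ones of the same type.  The type of a
voter is the preference list, and `key` is the price, refined so that no two voters have the same
key. -/
def IsLowerSetOf {K : Type} [LE K] (t : J → T) (key : J → K) (L : Finset J) : Prop :=
  ∀ i j, j ∈ L → t i = t j → key i ≤ key j → i ∈ L

theorem typeCount_sdiff_add_inter [DecidableEq J] (t : J → T) (S S' : Finset J) (τ : T) :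
    typeCount t (S \ S') τ + typeCount t (S ∩ S') τ = typeCount t S τ := by
  simp only [typeCount, Finset.card_filter]
  rw [add_comm]
  exact Finset.sum_inter_add_sum_sdiff S S' _

theorem typeCount_union [DecidableEq J] (t : J → T) {S S' : Finset J} (h : Disjoint S S') (τ : T) :
    typeCount t (S ∪ S') τ = typeCount t S τ + typeCount t S' τ := by
  simp only [typeCount, Finset.card_filter]
  exact Finset.sum_union h

theorem typeCount_mono (t : J → T) {S S' : Finset J} (h : S ⊆ S') (τ : T) :
    typeCount t S τ ≤ typeCount t S' τ :=
  Finset.card_le_card (Finset.filter_subset_filter _ h)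

theorem sum_le_sum_of_card_eq {J : Type} {A A' : Finset J} (p : J → ℕ) (hc : A.card = A'.card)
    (h : ∀ i ∈ A, ∀ j ∈ A', p i ≤ p j) : ∑ i ∈ A, p i ≤ ∑ j ∈ A', p j := by
  have h₁ := Finset.sum_le_card_nsmul A p (A.sup p) fun i hi => Finset.le_sup hi
  have h₂ := Finset.card_nsmul_le_sum A' p (A.sup p) fun j hj =>
    Finset.sup_le fun i hi => h i hi j hj
  rw [hc] at h₁
  exact h₁.trans h₂

/-- The basic price comparison: the common voters cancel, and in each type those that are only in
`S` are matched with equally many that are only in `S'`. -/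
theorem sum_le_sum_of_typeCount_eq [DecidableEq J] [Fintype T] (t : J → T) (p : J → ℕ)
    {S S' : Finset J}
    (hc : ∀ τ, typeCount t S τ = typeCount t S' τ)
    (h : ∀ i ∈ S, i ∉ S' → ∀ j ∈ S', j ∉ S → t i = t j → p i ≤ p j) :
    ∑ i ∈ S, p i ≤ ∑ j ∈ S', p j := by
  rw [← Finset.sum_inter_add_sum_sdiff S S', ← Finset.sum_inter_add_sum_sdiff S' S,
    Finset.inter_comm S' S]
  refine Nat.add_le_add_left ?_ _
  rw [← Finset.sum_fiberwise (S \ S') t, ← Finset.sum_fiberwise (S' \ S) t]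
  refine Finset.sum_le_sum fun τ _ => sum_le_sum_of_card_eq p ?_ fun i hi j hj => ?_
  · have h₁ := typeCount_sdiff_add_inter t S S' τ
    have h₂ := typeCount_sdiff_add_inter t S' S τ
    rw [Finset.inter_comm S' S] at h₂
    have h₃ := hc τ
    simp only [typeCount] at *
    omega
  · simp only [Finset.mem_filter, Finset.mem_sdiff] at hi hj
    exact h i hi.1.1 hi.1.2 j hj.1.1 hj.1.2 (hi.2.trans hj.2.symm)

/-- Subsets with prescribed numbers of elements of each type. -/
theorem exists_subset_typeCount_eq [DecidableEq J] [Fintype T] (t : J → T) {S : Finset J}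
    {k : T → ℕ}
    (hk : ∀ τ, k τ ≤ typeCount t S τ) : ∃ X ⊆ S, ∀ τ, typeCount t X τ = k τ := by
  choose B hB hc using fun τ => Finset.exists_subset_card_eq (hk τ)
  have ht : ∀ τ, ∀ j ∈ B τ, t j = τ := fun τ j hj => (Finset.mem_filter.1 (hB τ hj)).2
  refine ⟨Finset.univ.biUnion B, ?_, fun τ => ?_⟩
  · exact Finset.biUnion_subset.2 fun τ _ => (hB τ).trans (Finset.filter_subset _ _)
  · rw [← hc τ, typeCount]
    congr 1
    ext j
    simp only [Finset.mem_filter, Finset.mem_biUnion, Finset.mem_univ, true_and]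
    constructor
    · rintro ⟨⟨τ', hj⟩, rfl⟩
      rwa [ht τ' j hj]
    · exact fun hj => ⟨⟨τ, hj⟩, ht τ j hj⟩

variable {K : Type} [LinearOrder K] {t : J → T} {key : J → K}

theorem exists_initial_subset [DecidableEq J] (hkey : Function.Injective key) (A : Finset J) :
    ∀ k ≤ A.card, ∃ B ⊆ A, B.card = k ∧ ∀ i ∈ A, ∀ j ∈ B, key i ≤ key j → i ∈ B := by
  induction A using Finset.induction_on_max_value key with
  | empty => intro k hk; exact ⟨∅, by simp, (Nat.le_zero.1 hk).symm, by simp⟩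
  | insert a s ha hmax ih =>
    intro k hk
    rw [Finset.card_insert_of_notMem ha] at hk
    rcases Nat.lt_or_ge s.card k with hlt | hle
    · exact ⟨insert a s, subset_rfl, by rw [Finset.card_insert_of_notMem ha]; omega,
        fun i hi _ _ _ => hi⟩
    · obtain ⟨B, hB, hc, h⟩ := ih k hle
      refine ⟨B, hB.trans (Finset.subset_insert _ _), hc, fun i hi j hj hij => ?_⟩
      rcases Finset.mem_insert.1 hi with rfl | hi
      · have := hmax j (hB hj)
        rwa [hkey (le_antisymm hij this)]
      · exact h i hi j hj hij

/-- In each type, a set of voters can be replaced by equally many of the cheapest ones. -/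
theorem exists_isLowerSetOf [Fintype J] [DecidableEq J] (hkey : Function.Injective key)
    (S : Finset J) :
    ∃ L, IsLowerSetOf t key L ∧ ∀ τ, typeCount t L τ = typeCount t S τ := by
  choose B hB hc hl using fun τ => exists_initial_subset hkey
    (Finset.univ.filter fun j => t j = τ) (typeCount t S τ)
    (typeCount_mono t (Finset.subset_univ S) τ)
  have ht : ∀ τ, ∀ j ∈ B τ, t j = τ := fun τ j hj => (Finset.mem_filter.1 (hB τ hj)).2
  refine ⟨Finset.univ.filter fun j => j ∈ B (t j), fun i j hj hij hk => ?_, fun τ => ?_⟩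
  · simp only [Finset.mem_filter, Finset.mem_univ, true_and] at hj ⊢
    rw [hij]
    exact hl _ i (by simpa using hij) j hj hk
  · rw [← hc τ, typeCount]
    congr 1
    ext j
    simp only [Finset.mem_filter, Finset.mem_univ, true_and]
    constructor
    · rintro ⟨hj, rfl⟩
      exact hj
    · intro hj
      rw [ht τ j hj]
      exact ⟨hj, rfl⟩

theorem IsLowerSetOf.subset {L L' : Finset J} (hL : IsLowerSetOf t key L)
    (hL' : IsLowerSetOf t key L') (h : ∀ τ, typeCount t L τ ≤ typeCount t L' τ) : L ⊆ L' := by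
  intro i hi
  by_contra hi'
  have hss : L'.filter (fun j => t j = t i) ⊂ L.filter fun j => t j = t i := by
    refine Finset.ssubset_iff_of_subset (fun j hj => ?_) |>.2 ⟨i, by simpa using hi, by simp [hi']⟩
    simp only [Finset.mem_filter] at hj ⊢
    refine ⟨hL j i hi hj.2 ?_, hj.2⟩
    by_contra hlt
    exact hi' (hL' i j hj.1 hj.2.symm (not_le.1 hlt).le)
  exact absurd (h (t i)) (not_le.2 (Finset.card_lt_card hss))

theorem IsLowerSetOf.lt {T : Type} {t : J → T} {L : Finset J} (hL : IsLowerSetOf t key L)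
    {i j : J} (hi : i ∈ L) (hj : j ∉ L) (hij : t i = t j) : key i < key j := by
  by_contra h
  exact hj (hL j i hi hij.symm (not_lt.1 h))

/-- Defender and attacker may restrict themselves to lower sets: it never hurts the defender to
replace an awarded voter by a cheaper one of the same type (this costs less and leaves the more
expensive one to the attacker), and the attacker bribes the cheapest voters that are left. -/
theorem exists_protection_iff [Fintype J] [DecidableEq J] [Fintype T]
    (hkey : Function.Injective key) (p : J → ℕ) (hp : ∀ i j, key i ≤ key j → p i ≤ p j)
    (F B : ℕ) (Win : Finset J → Prop)
    (hWin : ∀ S S', (∀ τ, typeCount t S τ = typeCount t S' τ) → Win S → Win S') :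
    (∃ VF, ∑ j ∈ VF, p j ≤ F ∧ ∀ VB, Disjoint VB VF → ∑ j ∈ VB, p j ≤ B → ¬ Win VB) ↔
      ∃ L, IsLowerSetOf t key L ∧ ∑ j ∈ L, p j ≤ F ∧
        ∀ L', IsLowerSetOf t key L' → ∑ j ∈ L' \ L, p j ≤ B → ¬ Win (L' \ L) := by
  constructor
  · rintro ⟨VF, hF, h⟩
    obtain ⟨L, hL, hc⟩ := exists_isLowerSetOf (t := t) hkey VF
    refine ⟨L, hL, (sum_le_sum_of_typeCount_eq t p hc fun i hi _ j _ hj hij =>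
      hp i j (hL.lt hi hj hij).le).trans hF, fun L' hL' hB hw => ?_⟩
    -- Voters of `L' \ L` that are awarded in `VF` are replaced by voters of `L` that are not.
    obtain ⟨X, hX, hXc⟩ := exists_subset_typeCount_eq t (S := L \ VF)
      (k := typeCount t ((L' \ L) ∩ VF)) fun τ => by
        have h₁ := typeCount_sdiff_add_inter t L VF τ
        have h₂ := typeCount_sdiff_add_inter t VF L τ
        rw [Finset.inter_comm VF L] at h₂
        have h₃ := hc τ
        have h₄ : typeCount t ((L' \ L) ∩ VF) τ ≤ typeCount t (VF \ L) τ :=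
          typeCount_mono t (fun j hj => by
            simp only [Finset.mem_inter, Finset.mem_sdiff] at hj ⊢
            exact ⟨hj.2, hj.1.2⟩) τ
        omega
    have hdisj : Disjoint ((L' \ L) \ VF) X := Finset.disjoint_left.2 fun j hj hjX => by
      have := hX hjX
      simp only [Finset.mem_sdiff] at hj this
      exact hj.1.2 this.1
    have hcount : ∀ τ, typeCount t ((L' \ L) \ VF ∪ X) τ = typeCount t (L' \ L) τ := fun τ => by
      rw [typeCount_union t hdisj, hXc, typeCount_sdiff_add_inter]
    refine h ((L' \ L) \ VF ∪ X) ?_ (le_trans ?_ hB) (hWin _ _ (fun τ => (hcount τ).symm) hw)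
    · refine Finset.disjoint_left.2 fun j hj hjF => ?_
      rcases Finset.mem_union.1 hj with hj | hj
      · exact (Finset.mem_sdiff.1 hj).2 hjF
      · exact (Finset.mem_sdiff.1 (hX hj)).2 hjF
    · refine sum_le_sum_of_typeCount_eq t p hcount fun i hi hi' j hj _ hij => ?_
      have hiL : i ∈ L := by
        rcases Finset.mem_union.1 hi with hi | hi
        · exact absurd (Finset.mem_sdiff.1 hi).1 hi'
        · exact (Finset.mem_sdiff.1 (hX hi)).1
      exact hp i j (hL.lt hiL (Finset.mem_sdiff.1 hj).2 hij).le
  · rintro ⟨L, hL, hF, h⟩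
    refine ⟨L, hF, fun VB hVB hB hw => ?_⟩
    -- The attack on `VB` is replaced by one on `L' \ L`, where `L'` has as many voters of each type
    -- as `L ∪ VB`; these are the cheapest voters outside `L`.
    obtain ⟨L', hL', hc⟩ := exists_isLowerSetOf (t := t) hkey (L ∪ VB)
    have hsub : L ⊆ L' := hL.subset hL' fun τ => by
      rw [hc]
      exact typeCount_mono t Finset.subset_union_left τ
    have hcount : ∀ τ, typeCount t (L' \ L) τ = typeCount t VB τ := fun τ => by
      have h₁ := typeCount_sdiff_add_inter t L' L τ
      rw [Finset.inter_eq_right.2 hsub, hc, typeCount_union t hVB.symm] at h₁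
      omega
    refine h L' hL' (le_trans ?_ hB) (hWin _ _ (fun τ => (hcount τ).symm) hw)
    refine sum_le_sum_of_typeCount_eq t p hcount fun i hi _ j hj hj' hij => ?_
    have hjL : j ∉ L := Finset.disjoint_left.1 hVB hj
    have hjL' : j ∉ L' := fun h => hj' (Finset.mem_sdiff.2 ⟨h, hjL⟩)
    exact hp i j (hL'.lt (Finset.mem_sdiff.1 hi).1 hjL' hij).le

/-- A lower set is generated by the most expensive voters of each type in it. -/
theorem IsLowerSetOf.exists_generators [Fintype T] (hkey : Function.Injective key) {L : Finset J}
    (hL : IsLowerSetOf t key L) : ∃ X : Finset J, X.card ≤ Fintype.card T ∧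
      ∀ i, i ∈ L ↔ ∃ j ∈ X, t i = t j ∧ key i ≤ key j := by
  refine ⟨L.filter fun j => ∀ i ∈ L, t i = t j → key i ≤ key j, ?_, fun i => ⟨fun hi => ?_, ?_⟩⟩
  · refine Finset.card_le_card_of_injOn t (fun _ _ => Finset.mem_coe.2 (Finset.mem_univ _)) ?_
    intro i hi j hj hij
    simp only [Finset.coe_filter, Set.mem_ofPred_eq] at hi hj
    exact hkey (le_antisymm (hj.2 i hi.1 hij) (hi.2 j hj.1 hij.symm))
  · obtain ⟨j, hj, hmax⟩ := Finset.exists_max_image (L.filter fun j => t j = t i) key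
      ⟨i, by simpa using hi⟩
    simp only [Finset.mem_filter] at hj hmax
    refine ⟨j, ?_, hj.2.symm, hmax i ⟨hi, rfl⟩⟩
    simp only [Finset.mem_filter]
    exact ⟨hj.1, fun k hk hkj => hmax k ⟨hk, hkj.trans hj.2⟩⟩
  · rintro ⟨j, hj, hij, hk⟩
    exact hL i j (Finset.mem_filter.1 hj).1 hij hk

end Exchange

/-! ### Correctness of the algorithm -/

section Enumeration

theorem mem_shortLists {α : Type} {l : List α} {k : ℕ} {X : List α} (hk : X.length ≤ k)
    (hX : ∀ x ∈ X, x ∈ l) : X ∈ shortLists k l := by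
  induction k generalizing X with
  | zero => simp [shortLists, List.length_eq_zero_iff.1 (Nat.le_zero.1 hk)]
  | succ k ih =>
    rw [shortLists, List.mem_flatMap]
    cases X with
    | nil => exact ⟨[], ih (by simp) (by simp), by simp⟩
    | cons x X =>
      exact ⟨X, ih (by simpa using hk) fun y hy => hX y (List.mem_cons_of_mem _ hy),
        List.mem_cons_of_mem _ (List.mem_map_of_mem (hX x List.mem_cons_self))⟩

/-- Up to the order, `blockLists` enumerates all lists of bounded length. -/
theorem exists_mem_blockLists_perm {α β : Type} [DecidableEq α] {ts : List α} {l : List β}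
    {R : List α} (hR : ∀ x ∈ R, x ∈ ts) (hl : R.length ≤ l.length) :
    ∃ R' ∈ blockLists ts l, R'.Perm R := by
  induction ts generalizing R with
  | nil =>
    obtain rfl : R = [] := List.eq_nil_iff_forall_not_mem.2 fun x hx => by simpa using hR x hx
    exact ⟨[], by simp [blockLists], List.Perm.refl _⟩
  | cons τ ts ih =>
    obtain ⟨w, hw, hp⟩ := ih (R := R.filter fun x => !(x == τ)) (fun x hx => by
        simp only [List.mem_filter, Bool.not_eq_true', beq_eq_false_iff_ne] at hx
        simpa [hx.2] using hR x hx.1)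
      ((List.length_filter_le _ _).trans hl)
    have hc : R.count τ ≤ l.length := List.count_le_length.trans hl
    refine ⟨List.replicate (R.count τ) τ ++ w, ?_, ?_⟩
    · rw [blockLists, List.mem_flatMap]
      refine ⟨w, hw, List.mem_map.2 ⟨l.drop (l.length - R.count τ), ?_, ?_⟩⟩
      · exact (List.mem_tails _ _).2 (List.drop_suffix _ _)
      · rw [List.length_drop, Nat.sub_sub_self hc]
    · rw [← List.filter_beq]
      exact (List.Perm.append_left _ hp).trans (List.filter_append_perm _ _)

/-- Every multiset of the right size can be distributed to the elements of a finite set. -/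
theorem exists_map_val_eq {J T : Type} [Nonempty T] [DecidableEq J] (s : Finset J)
    {R : Multiset T} (h : R.card = s.card) : ∃ f : J → T, s.val.map f = R := by
  induction s using Finset.induction_on generalizing R with
  | empty =>
    exact ⟨fun _ => Classical.arbitrary T, by simpa using (Multiset.card_eq_zero.1 h).symm⟩
  | insert a s ha ih =>
    rw [Finset.card_insert_of_notMem ha] at h
    obtain ⟨b, hb⟩ := Multiset.card_pos_iff_exists_mem.1 (show 0 < R.card by omega)
    obtain ⟨R, rfl⟩ := Multiset.exists_cons_of_mem hb
    obtain ⟨f, hf⟩ := ih (R := R) (by simpa using h)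
    refine ⟨Function.update f a b, ?_⟩
    rw [Finset.insert_val_of_notMem ha, Multiset.map_cons, Function.update_self, ← hf]
    congr 1
    refine Multiset.map_congr rfl fun j hj => Function.update_of_ne ?_ _ _
    rintro rfl
    exact ha hj

/-- The elements of a list that satisfy a condition, as the image of a set of indices. -/
theorem coe_filter_map_finRange {α : Type} {n : ℕ} (f : Fin n → α) (q : α → Bool)
    {s : Finset (Fin n)} (hs : ∀ j, j ∈ s ↔ q (f j) = true) :
    (((List.finRange n).map f).filter q : Multiset α) = s.val.map f := by
  have : s = Finset.univ.filter fun j => q (f j) = true := by ext j; simp [hs]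
  have hv : (Finset.univ.filter fun j => q (f j) = true).val =
      ((List.finRange n).filter fun j => decide (q (f j) = true) : Multiset (Fin n)) := rfl
  rw [this, List.filter_map, ← Multiset.map_coe, hv]
  simp [Function.comp_def]

end Enumeration

section Procedure

/-- Price and tie-break of a voter, compared lexicographically. -/
def voterKey (a : VoterData m) : ℕ ×ₗ ℕ := toLex (bitsValue a.2.1, bitsValue a.2.2)

theorem isBelow_iff (a x : VoterData m) :
    isBelow a x = true ↔ a.1 = x.1 ∧ voterKey a ≤ voterKey x := by
  simp only [isBelow, Bool.and_eq_true, decide_eq_true_eq, Bool.or_eq_true, Bool.not_eq_true',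
    ← Bool.not_eq_true, leBits_iff, voterKey, Prod.Lex.le_iff, ofLex_toLex]
  refine and_congr_right fun _ => ?_
  omega

variable {n : ℕ} (data : Fin n → VoterData m)

/-- The set of voters that is generated by `X`. -/
def downSet (X : List (VoterData m)) : Finset (Fin n) :=
  Finset.univ.filter fun j => inDown X (data j) = true

theorem mem_downSet {X : List (VoterData m)} {j : Fin n} :
    j ∈ downSet data X ↔ ∃ x ∈ X, (data j).1 = x.1 ∧ voterKey (data j) ≤ voterKey x := by
  rw [downSet, Finset.mem_filter, inDown, List.any_eq_true]
  simp only [Finset.mem_univ, true_and, isBelow_iff]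

theorem isLowerSetOf_downSet (X : List (VoterData m)) :
    IsLowerSetOf (fun j => (data j).1) (fun j => voterKey (data j)) (downSet data X) := by
  intro i j hj hij hk
  obtain ⟨x, hx, h₁, h₂⟩ := (mem_downSet data).1 hj
  exact (mem_downSet data).2 ⟨x, hx, hij.trans h₁, hk.trans h₂⟩

/-- Every lower set is found by the procedure. -/
theorem exists_downSet_eq (hkey : Function.Injective fun j => voterKey (data j))
    {L : Finset (Fin n)}
    (hL : IsLowerSetOf (fun j => (data j).1) (fun j => voterKey (data j)) L) :
    ∃ X ∈ shortLists (Fintype.card (Ranking m)) ((List.finRange n).map data),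
      downSet data X = L := by
  obtain ⟨X, hX, h⟩ := hL.exists_generators hkey
  refine ⟨X.toList.map data, mem_shortLists (by simpa using hX) fun x hx => ?_, ?_⟩
  · obtain ⟨j, -, rfl⟩ := List.mem_map.1 hx
    exact List.mem_map_of_mem (List.mem_finRange j)
  · ext i
    simp [mem_downSet, h]

/-- An attack that bribes the voters in `D` can succeed; `G` says which multisets of reported lists
are successful. -/
def CanWin (G : Multiset (Ranking m) → Prop) (pref : Fin n → Ranking m) (D : Finset (Fin n)) :
    Prop :=
  ∃ R : Multiset (Ranking m), R.card = D.card ∧ G (Dᶜ.val.map pref + R)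

/-- Voters with the same preference list are interchangeable for the attacker, apart from prices. -/
theorem CanWin.congr {G : Multiset (Ranking m) → Prop} {pref : Fin n → Ranking m}
    {S S' : Finset (Fin n)} (h : ∀ τ, typeCount pref S τ = typeCount pref S' τ)
    (hS : CanWin G pref S) : CanWin G pref S' := by
  obtain ⟨R, hR, hG⟩ := hS
  have hcard : ∀ S : Finset (Fin n), S.card = ∑ τ, typeCount pref S τ := fun S =>
    Finset.card_eq_sum_card_fiberwise fun _ _ => Finset.mem_coe.2 (Finset.mem_univ _)
  have hmap : Sᶜ.val.map pref = S'ᶜ.val.map pref := by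
    ext τ
    have hc : ∀ S : Finset (Fin n), (S.val.map pref).count τ = typeCount pref S τ := fun S => by
      rw [Multiset.count_map, typeCount, Finset.card_def, Finset.filter_val]
      simp only [eq_comm]
    have hu : ∀ S : Finset (Fin n), typeCount pref Sᶜ τ + typeCount pref S τ =
        typeCount pref Finset.univ τ := fun S => by
      rw [← typeCount_union pref disjoint_compl_left, Finset.union_comm, Finset.union_compl]
    have h₁ := hu S
    have h₂ := hu S'
    have h₃ := h τ
    rw [hc, hc]
    omega
  refine ⟨R, ?_, hmap ▸ hG⟩
  rw [hR, hcard, hcard]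
  exact Finset.sum_congr rfl fun τ _ => h τ

theorem bitsValue_costBits {q : VoterData m → Bool} {s : Finset (Fin n)}
    (hs : ∀ j, j ∈ s ↔ q (data j) = true) :
    bitsValue (costBits (((List.finRange n).map data).filter q)) =
      ∑ j ∈ s, bitsValue (data j).2.1 := by
  have h := congrArg (fun M : Multiset (VoterData m) => (M.map fun a => bitsValue a.2.1).sum)
    (coe_filter_map_finRange data q hs)
  simp only [Multiset.map_map, Multiset.map_coe, Multiset.sum_coe] at h
  rw [costBits, bitsValue_sumBits, List.map_map]
  exact h

theorem resists_iff {success : List (List Bool) → List (Ranking m) → Bool}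
    {scores : List (List Bool)} {G : Multiset (Ranking m) → Prop}
    (hG : ∀ L : List (Ranking m), success scores L = true ↔ G L) {q : VoterData m → Bool}
    {s : Finset (Fin n)} (hs : ∀ j, j ∈ s ↔ q (data j) = true) :
    resists success scores (((List.finRange n).map data).filter q)
        (((List.finRange n).map data).filter fun a => !q a) = true ↔
      ¬ CanWin G (fun j => (data j).1) s := by
  have hD := coe_filter_map_finRange data q hs
  have hU := coe_filter_map_finRange data (fun a => !q a) (s := sᶜ) fun j => by
    simp [hs]
  have hU' : ((((List.finRange n).map data).filter fun a => !q a).map (fun a => a.1) :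
      Multiset (Ranking m)) = sᶜ.val.map fun j => (data j).1 := by
    rw [← Multiset.map_coe, hU, Multiset.map_map]
    rfl
  have hlen : (((List.finRange n).map data).filter q).length = s.card := by
    rw [← Multiset.coe_card, hD, Multiset.card_map, Finset.card_def]
  simp only [resists, List.all_eq_true, Bool.or_eq_true, Bool.not_eq_true', ← Bool.not_eq_true,
    sameLength_iff, hG, hlen, ← Multiset.coe_add, hU', CanWin, not_exists, not_and]
  constructor
  · intro h R hR hw
    obtain ⟨R', hR', hp⟩ := exists_mem_blockLists_perm (R := R.toList)
      (ts := (Finset.univ : Finset (Ranking m)).toList)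
      (l := ((List.finRange n).map data).filter q ++
        ((List.finRange n).map data).filter fun a => !q a) (fun x _ => by simp)
      (by rw [Multiset.length_toList, hR, List.length_append, hlen]; omega)
    have hc : (R' : Multiset (Ranking m)) = R := by
      rw [← Multiset.coe_toList R]
      exact Multiset.coe_eq_coe.2 hp
    rcases h R' hR' with h | h
    · exact h (by rw [← hR, ← hc, Multiset.coe_card])
    · exact h (hc ▸ hw)
  · intro h R _
    by_cases hl : R.length = s.card
    · exact Or.inr (h R (by simpa using hl))
    · exact Or.inl hl

/-- Correctness of the decision procedure: the sets it tries are exactly the lower sets, and these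
suffice for both players by `exists_protection_iff`. -/
theorem isProtectable_iff {success : List (List Bool) → List (Ranking m) → Bool}
    {r : RawInput m} {G : Multiset (Ranking m) → Prop}
    (hG : ∀ L : List (Ranking m), success r.1 L = true ↔ G L)
    (hdata : voterData r.2 = (List.finRange n).map data)
    (hkey : Function.Injective fun j => voterKey (data j)) :
    isProtectable success r = true ↔
      ∃ VF, ∑ j ∈ VF, bitsValue (data j).2.1 ≤ bitsValue (r.1.getD (m + 1) []) ∧
        ∀ VB, Disjoint VB VF →
          ∑ j ∈ VB, bitsValue (data j).2.1 ≤ bitsValue (r.1.getD (m + 2) []) →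
            ¬ CanWin G (fun j => (data j).1) VB := by
  have hX : ∀ X j, j ∈ downSet data X ↔ inDown X (data j) = true := fun X j => by simp [downSet]
  have hXY : ∀ X Y j, j ∈ downSet data Y \ downSet data X ↔ isBribed X Y (data j) = true :=
    fun X Y j => by simp [downSet, isBribed]
  rw [exists_protection_iff hkey _ (fun i j hij => ?_) _ _ (CanWin G fun j => (data j).1)
    fun S S' h hS => hS.congr h]
  · simp only [isProtectable, hdata, List.any_eq_true, Bool.and_eq_true, List.all_eq_true,
      Bool.or_eq_true, Bool.not_eq_true', ← Bool.not_eq_true, leBits_iff,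
      bitsValue_costBits data (hX _), bitsValue_costBits data (hXY _ _),
      resists_iff data hG (hXY _ _)]
    constructor
    · rintro ⟨X, -, hF, h⟩
      refine ⟨downSet data X, isLowerSetOf_downSet data X, hF, fun L' hL' hB => ?_⟩
      obtain ⟨Y, hY, rfl⟩ := exists_downSet_eq data hkey hL'
      exact (h Y hY).resolve_left fun h => h hB
    · rintro ⟨L, hL, hF, h⟩
      obtain ⟨X, hX, rfl⟩ := exists_downSet_eq data hkey hL
      refine ⟨X, hX, hF, fun Y _ => ?_⟩
      by_cases hB : ∑ j ∈ downSet data Y \ downSet data X, bitsValue (data j).2.1 ≤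
          bitsValue (r.1.getD (m + 2) [])
      · exact Or.inr (h _ (isLowerSetOf_downSet data Y) hB)
      · exact Or.inl hB
  · rcases Prod.Lex.le_iff.1 hij with h | h
    · exact h.le
    · exact h.1.le

end Procedure

/-! ### Instances and the two languages -/

section Words

theorem isCanonical_cons (b : Bool) (x : List Bool) :
    isCanonical (b :: x) = if x = [] then b else isCanonical x := by
  simp only [isCanonical, List.headD_eq_head?_getD, List.head?_reverse]
  cases x <;> simp [List.getLast?_cons_cons]

theorem isCanonical_bits (n : ℕ) : isCanonical n.bits = true := by
  induction n using Nat.binaryRec' with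
  | zero => rfl
  | bit b n h ih =>
    rw [Nat.bits_append_bit _ _ h, isCanonical_cons, ih]
    split_ifs with hn
    · refine h ?_
      rw [← bitsValue_bits n, hn, bitsValue_nil]
    · rfl

/-- Canonical words are the ones that `Nat.bits` produces. -/
theorem bits_bitsValue {x : List Bool} (h : isCanonical x = true) : (bitsValue x).bits = x := by
  induction x with
  | nil => rfl
  | cons b x ih =>
    rw [isCanonical_cons] at h
    have hv : bitsValue (b :: x) = Nat.bit b (bitsValue x) := by
      rw [bitsValue_cons, Nat.bit_val]; ring
    split_ifs at h with hx
    · subst hx h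
      rfl
    · rw [hv, Nat.bits_append_bit _ _ fun h₀ => ?_, ih h]
      have := ih h
      rw [h₀] at this
      exact absurd this.symm hx

/-- Indexing a list by its nonempty suffixes. -/
theorem tails_flatMap_take {α β : Type} (l : List α) (g : ℕ → α → β) :
    (l.tails.flatMap fun t => (t.take 1).map (g t.length)) =
      (List.finRange l.length).map fun j : Fin l.length => g (l.length - j) (l.get j) := by
  induction l with
  | nil => simp
  | cons a l ih =>
    rw [List.tails_cons, List.flatMap_cons, ih]
    simp [List.finRange_succ, Function.comp_def]

/-- The contents of the word that encodes an instance. -/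
def ProtectionInstance.raw (I : ProtectionInstance m) : RawInput m :=
  ((List.ofFn I.rule.score).map Nat.bits ++ [I.defenseBudget.bits, I.attackBudget.bits],
    I.voters.map fun v => (v.pref, [v.weight.bits, v.awardPrice.bits, v.bribePrice.bits]))

theorem ProtectionInstance.encode_raw (I : ProtectionInstance m) : I.raw.encode = I.encode := by
  have hn : (encodeNumber : ℕ → List (InputSymbol m)) =
      fun k => k.bits.map InputSymbol.bit ++ [InputSymbol.endNum] := rfl
  have hv : (Voter.encode : Voter m → _) = fun v => InputSymbol.pref v.pref ::
      (encodeNumber v.weight ++ encodeNumber v.awardPrice ++ encodeNumber v.bribePrice) := rfl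
  simp [raw, RawInput.encode, ProtectionInstance.encode, hn, hv, List.flatMap_map,
    -List.ofFn_succ, -List.map_ofFn]

theorem ProtectionInstance.score_raw (I : ProtectionInstance m) (i : Fin (m + 1)) :
    I.raw.1.getD i [] = (I.rule.score i).bits := by
  have h : (i : ℕ) < ((List.ofFn I.rule.score).map Nat.bits).length := by
    simpa only [List.length_map, List.length_ofFn] using i.isLt
  rw [raw, List.getD_append _ _ _ _ h, List.getD_eq_getElem _ _ h, List.getElem_map,
    List.getElem_ofFn]

theorem ProtectionInstance.defenseBudget_raw (I : ProtectionInstance m) :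
    I.raw.1.getD (m + 1) [] = I.defenseBudget.bits := by
  rw [raw, List.getD_append_right _ _ _ _ (by simp)]
  simp

theorem ProtectionInstance.attackBudget_raw (I : ProtectionInstance m) :
    I.raw.1.getD (m + 2) [] = I.attackBudget.bits := by
  rw [raw, List.getD_append_right _ _ _ _ (by simp)]
  simp

theorem eqBits_iff (x y : List Bool) : eqBits x y = true ↔ bitsValue x = bitsValue y := by
  rw [eqBits, Bool.and_eq_true, leBits_iff, leBits_iff, le_antisymm_iff]

theorem isValidVoter_of_voter (v : Voter m) (hw : v.weight = 1) (hp : v.awardPrice = v.bribePrice) :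
    isValidVoter [v.weight.bits, v.awardPrice.bits, v.bribePrice.bits] = true := by
  have := v.bribePrice_pos
  simp [isValidVoter, sameLength_iff, isCanonical_bits, eqBits_iff, bitsValue_bits, hw, hp,
    ← Bool.not_eq_true, leBits_iff]
  exact ⟨rfl, this.ne'⟩

theorem exists_voter {v : Ranking m × List (List Bool)} (h : isValidVoter v.2 = true) :
    ∃ u : Voter m, u.weight = 1 ∧ u.awardPrice = u.bribePrice ∧
      (u.pref, [u.weight.bits, u.awardPrice.bits, u.bribePrice.bits]) = v := by
  obtain ⟨τ, l⟩ := v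
  simp only [isValidVoter, Bool.and_eq_true, sameLength_iff, List.length_replicate,
    eqBits_iff, Bool.not_eq_true', ← Bool.not_eq_true, leBits_iff, List.all_eq_true] at h
  obtain ⟨⟨⟨⟨hl, hc⟩, hw⟩, hp⟩, h₀⟩ := h
  match l, hl with
  | [w, p, p'], _ =>
    simp only [List.mem_cons, List.not_mem_nil, or_false, forall_eq_or_imp, forall_eq,
      List.getD_cons_zero, List.getD_cons_succ, bitsValue_nil, not_le] at hc hw hp h₀
    refine ⟨⟨τ, bitsValue w, bitsValue p, bitsValue p', ?_, h₀, hp ▸ h₀⟩, ?_, hp, ?_⟩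
    · simp [hw]
    · simp [hw]
    · simp [bits_bitsValue, hc]

theorem ProtectionInstance.isValid_raw (I : ProtectionInstance m) (hw : I.UnitWeights)
    (hs : I.Symmetric) : isValid m I.raw = true := by
  simp only [isValid, Bool.and_eq_true, sameLength_iff, List.all_eq_true, Bool.or_eq_true,
    leBits_iff, score_raw, bitsValue_bits]
  refine ⟨⟨⟨?_, ?_⟩, fun i _ j _ => ?_⟩, ?_⟩
  · simp [raw]
  · intro x hx
    simp only [raw, List.mem_append, List.mem_map, List.mem_cons, List.not_mem_nil, or_false] at hx
    rcases hx with ⟨k, -, rfl⟩ | rfl | rfl <;> exact isCanonical_bits _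
  · by_cases hij : i ≤ j
    · exact Or.inr (I.rule.antitone hij)
    · exact Or.inl (by simp [hij])
  · intro x hx
    obtain ⟨v, hv, rfl⟩ := List.mem_map.1 hx
    exact isValidVoter_of_voter v (hw v hv) (hs v hv)

/-- The test `isValid` accepts only contents of instances, with unit weights and equal prices.  It
also tests that numbers are written canonically, so that the instance has exactly these contents. -/
theorem exists_raw_eq {r : RawInput m} (h : isValid m r = true) :
    ∃ I : ProtectionInstance m, I.raw = r ∧ I.UnitWeights ∧ I.Symmetric := by
  simp only [isValid, Bool.and_eq_true, sameLength_iff, List.all_eq_true, Bool.or_eq_true,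
    leBits_iff, List.length_replicate, List.mem_finRange, true_imp_iff] at h
  obtain ⟨⟨⟨hl, hc⟩, ha⟩, hv⟩ := h
  have : Nonempty (Voter m) := ⟨⟨1, 1, 1, 1, one_pos, one_pos, one_pos⟩⟩
  choose! u hu₁ hu₂ hu₃ using fun v (hv' : v ∈ r.2) => exists_voter (hv v hv')
  let I : ProtectionInstance m :=
    { rule := ⟨fun i => bitsValue (r.1.getD i []), fun i j hij =>
        (ha i j).resolve_left (by simp [hij])⟩
      defenseBudget := bitsValue (r.1.getD (m + 1) [])
      attackBudget := bitsValue (r.1.getD (m + 2) [])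
      voters := r.2.map u }
  refine ⟨I, Prod.ext ?_ ?_, fun v hv => ?_, fun v hv => ?_⟩
  · have hget : ∀ i < m + 3, (bitsValue (r.1.getD i [])).bits = r.1.getD i [] := fun i hi => by
      refine bits_bitsValue (hc _ ?_)
      rw [List.getD_eq_getElem _ _ (by omega)]
      exact List.getElem_mem _
    refine List.ext_getElem (by simp [ProtectionInstance.raw, hl]) fun i h₁ h₂ => ?_
    rw [← List.getD_eq_getElem _ [] h₁, ← List.getD_eq_getElem _ [] h₂]
    rcases Nat.lt_or_ge i (m + 1) with hi | hi
    · exact (I.score_raw ⟨i, hi⟩).trans (hget i (by omega))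
    · obtain rfl | rfl : i = m + 1 ∨ i = m + 2 := by omega
      · exact I.defenseBudget_raw.trans (hget _ (by omega))
      · exact I.attackBudget_raw.trans (hget _ (by omega))
  · simp only [ProtectionInstance.raw, I, List.map_map]
    exact (List.map_congr_left fun v hv => hu₃ v hv).trans (List.map_id _)
  · obtain ⟨x, hx, rfl⟩ := List.mem_map.1 hv
    exact hu₁ x hx
  · obtain ⟨x, hx, rfl⟩ := List.mem_map.1 hv
    exact hu₂ x hx

end Words

section Attacks

variable (I : ProtectionInstance m)

/-- The data of the `j`-th voter. -/
def ProtectionInstance.data (j : Fin I.voters.length) : VoterData m :=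
  ((I.voter j).pref, (I.voter j).awardPrice.bits, List.replicate (I.voters.length - j) true)

theorem ProtectionInstance.voterData_raw :
    voterData I.raw.2 = (List.finRange I.voters.length).map I.data := by
  have h := tails_flatMap_take I.voters fun k v =>
    ((v.pref, v.awardPrice.bits, List.replicate k true) : VoterData m)
  rw [voterData, ProtectionInstance.raw, List.map_tails, List.flatMap_map]
  refine Eq.trans ?_ h
  simp [← List.map_take, Function.comp_def]

/-- Different voters have different tie-breaks: `k` digits `1` have the value `2 ^ k - 1`. -/
theorem ProtectionInstance.voterKey_injective :
    Function.Injective fun j => voterKey (I.data j) := by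
  intro i j hij
  have h : bitsValue (List.replicate (I.voters.length - i) true) =
      bitsValue (List.replicate (I.voters.length - j) true) := congrArg (fun p => (ofLex p).2) hij
  have h₁ := bitsValue_ones (I.voters.length - i)
  have h₂ := bitsValue_ones (I.voters.length - j)
  rw [h, h₂] at h₁
  have := Nat.pow_right_injective le_rfl h₁
  ext
  omega

/-- A protection exists if and only if it exists for the description of attacks by multisets of
reported lists. -/
theorem ProtectionInstance.exists_protection_iff_canWin (hs : I.Symmetric)
    {P : (Fin I.voters.length → Ranking m) → Prop} {G : Multiset (Ranking m) → Prop}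
    (hP : ∀ π, P π ↔ G (Finset.univ.val.map π)) :
    (∃ VF, I.Affordable VF ∧ ∀ π, I.Reachable VF π → ¬ P π) ↔
      ∃ VF, ∑ j ∈ VF, (I.voter j).awardPrice ≤ I.defenseBudget ∧ ∀ VB, Disjoint VB VF →
        ∑ j ∈ VB, (I.voter j).awardPrice ≤ I.attackBudget →
          ¬ CanWin G (fun j => (I.voter j).pref) VB := by
  have hprice : ∀ j, (I.voter j).awardPrice = (I.voter j).bribePrice := fun j =>
    hs _ (List.get_mem _ _)
  have hsplit : ∀ (π : Fin I.voters.length → Ranking m) (VB : Finset (Fin I.voters.length)),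
      Finset.univ.val.map π = VBᶜ.val.map π + VB.val.map π := fun π VB => by
    rw [← Multiset.map_add, ← Finset.disjUnion_val _ _ disjoint_compl_left,
      Finset.disjUnion_eq_union, Finset.union_comm, Finset.union_compl]
  refine exists_congr fun VF => and_congr_right fun _ => ⟨fun h VB hd hB hw => ?_,
    fun h π hπ hP' => ?_⟩
  · obtain ⟨R, hR, hG⟩ := hw
    obtain ⟨f, rfl⟩ := exists_map_val_eq VB hR
    refine h (fun j => if j ∈ VB then f j else (I.voter j).pref)
      ⟨VB, hd, by simpa only [hprice] using hB, fun j hj => by simp [hj]⟩ ((hP _).2 ?_)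
    rw [hsplit _ VB]
    convert hG using 2
    · exact Multiset.map_congr rfl fun j hj => if_neg (Finset.mem_compl.1 hj)
    · exact Multiset.map_congr rfl fun j hj => if_pos hj
  · obtain ⟨VB, hd, hB, hπ⟩ := hπ
    refine h VB hd (by simpa only [hprice] using hB) ⟨VB.val.map π, by simp, ?_⟩
    rw [hP, hsplit π VB] at hP'
    convert hP' using 2
    exact Multiset.map_congr rfl fun j hj => (hπ j (Finset.mem_compl.1 hj)).symm

/-- The score of candidate `c` when the lists in `R` are reported. -/
def ProtectionInstance.multisetScore (c : Fin (m + 1)) (R : Multiset (Ranking m)) : ℕ :=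
  (R.map fun σ => I.rule.score (σ.symm c)).sum

theorem ProtectionInstance.totalScore_eq (hw : I.UnitWeights)
    (π : Fin I.voters.length → Ranking m) (c : Fin (m + 1)) :
    I.totalScore π c = I.multisetScore c (Finset.univ.val.map π) := by
  have : ∀ j, (I.voter j).weight = 1 := fun j => hw _ (List.get_mem _ _)
  simp [totalScore, multisetScore, this, Finset.sum, Function.comp_def]

theorem ProtectionInstance.bitsValue_scoreBits (c : Fin (m + 1)) (L : List (Ranking m)) :
    bitsValue (scoreBits I.raw.1 c L) = I.multisetScore c L := by
  rw [scoreBits, bitsValue_sumBits, multisetScore, List.map_map, Multiset.map_coe,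
    Multiset.sum_coe]
  simp only [Function.comp_def, score_raw, bitsValue_bits]

/-- On encoded instances the procedure decides whether a protection exists, for any notion of a
successful attack that is tested by `success`. -/
theorem ProtectionInstance.isProtectable_raw_iff (hs : I.Symmetric)
    {success : List (List Bool) → List (Ranking m) → Bool}
    {P : (Fin I.voters.length → Ranking m) → Prop} {G : Multiset (Ranking m) → Prop}
    (hP : ∀ π, P π ↔ G (Finset.univ.val.map π))
    (hG : ∀ L : List (Ranking m), success I.raw.1 L = true ↔ G L) :
    isProtectable success I.raw = true ↔
      ∃ VF, I.Affordable VF ∧ ∀ π, I.Reachable VF π → ¬ P π := by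
  rw [I.exists_protection_iff_canWin hs hP,
    isProtectable_iff I.data hG I.voterData_raw I.voterKey_injective, I.defenseBudget_raw,
    I.attackBudget_raw]
  simp only [ProtectionInstance.data, bitsValue_bits]

theorem ProtectionInstance.isProtectable_winsBits_iff (hw : I.UnitWeights) (hs : I.Symmetric) :
    isProtectable (winsBits m) I.raw = true ↔ I.ConstructiveYes := by
  refine I.isProtectable_raw_iff hs (G := fun R => ∀ c, c ≠ Fin.last m →
    I.multisetScore c R < I.multisetScore (Fin.last m) R) (fun π => ?_) fun L => ?_
  · simp only [DesignatedWins, I.totalScore_eq hw]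
  · simp only [winsBits, List.all_eq_true, List.mem_finRange, true_imp_iff, Bool.or_eq_true,
      decide_eq_true_eq, Bool.not_eq_true', ← Bool.not_eq_true, leBits_iff,
      I.bitsValue_scoreBits, not_le, or_iff_not_imp_left, ne_eq]

theorem ProtectionInstance.isProtectable_losesBits_iff (hw : I.UnitWeights) (hs : I.Symmetric) :
    isProtectable (losesBits m) I.raw = true ↔ I.DestructiveYes := by
  refine I.isProtectable_raw_iff hs (G := fun R => ∃ c, c ≠ Fin.last m ∧
    I.multisetScore (Fin.last m) R < I.multisetScore c R) (fun π => ?_) fun L => ?_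
  · simp only [DesignatedLoses, I.totalScore_eq hw]
  · simp only [losesBits, List.any_eq_true, List.mem_finRange, true_and, Bool.not_eq_true',
      ← Bool.not_eq_true, leBits_iff, I.bitsValue_scoreBits, not_le]
    refine exists_congr fun c => ⟨fun h => ⟨?_, h⟩, fun h => h.2⟩
    rintro rfl
    exact lt_irrefl _ h

end Attacks

/-- A problem is in P if the procedure decides its instances; words that do not encode a symmetric
instance with unit weights are rejected. -/
theorem inP_of_isProtectable {m : ℕ} {success : List (List Bool) → List (Ranking m) → Bool}
    (hsuccess : PolyTime fun p : List (List Bool) × List (Ranking m) => success p.1 p.2)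
    {Yes : ProtectionInstance m → Prop}
    (hYes : ∀ I : ProtectionInstance m, I.UnitWeights → I.Symmetric →
      (isProtectable success I.raw = true ↔ Yes I)) :
    InP ({w | ∃ I : ProtectionInstance m, I.encode = w ∧ I.UnitWeights ∧ I.Symmetric ∧ Yes I} :
      Language (InputSymbol m)) := by
  have h₁ : PolyTime fun p : List (InputSymbol m) × RawInput m =>
      isValid m p.2 && isProtectable success p.2 :=
    (polyTime_isValid.comp (f := fun p : List (InputSymbol m) × RawInput m => p.2)
      (by fun_prop)).and ((polyTime_isProtectable hsuccess).comp
        (f := fun p : List (InputSymbol m) × RawInput m => p.2) (by fun_prop))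
  have h₂ : PolyTime fun w : List (InputSymbol m) => (parse w.reverse).elim false fun r =>
      isValid m r && isProtectable success r :=
    PolyTime.optionElim (g := fun _ r => isValid m r && isProtectable success r)
      (polyTime_parse (by fun_prop)) (PolyTime.const false) h₁
  refine h₂.inP _ fun w => ?_
  rw [List.reverse_reverse]
  constructor
  · rintro ⟨I, rfl, hw, hs, hI⟩
    rw [← I.encode_raw, parse_encode, Option.elim_some, I.isValid_raw hw hs,
      (hYes I hw hs).2 hI]
    rfl
  · intro h
    cases hp : parse w with
    | none => simp [hp] at h
    | some r =>
      rw [hp, Option.elim_some, Bool.and_eq_true] at h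
      obtain ⟨I, rfl, hw, hs⟩ := exists_raw_eq h.1
      exact ⟨I, by rw [← I.encode_raw, encode_of_parse hp], hw, hs, (hYes I hw hs).1 h.2⟩

theorem theorem5 (m : ℕ) :
    InP (constructiveSymmetricDollarProtection m) ∧
      InP (destructiveSymmetricDollarProtection m) :=
  ⟨inP_of_isProtectable polyTime_winsBits fun I => I.isProtectable_winsBits_iff,
    inP_of_isProtectable polyTime_losesBits fun I => I.isProtectable_losesBits_iff⟩
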